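/- Let $n\ge 3$ and let $\mathcal{DP}_n$ be the monoid of all partial isometries of $\{1,\dots,n\}$, i.e. of all partial injective maps $\alpha$ of $\{1,\dots,n\}$ into itself with $|i\alpha-j\alpha|=|i-j|$ for all $i,j\in\mathrm{Dom}(\alpha)$, under composition of partial maps (written on the right, composed from left to right). Put $m=\lfloor\frac{n-1}{2}\rfloor$ and $m'=\lceil\frac{n-3}{2}\rceil$. Let $h\in\mathcal{DP}_n$ be the permutation $k\mapsto n+1-k$, let $x_n\in\mathcal{DP}_n$ be the map $k\mapsto k-1$ with domain $\{2,\dots,n\}$, and for $1\le i\le m$ let $x_i\in\mathcal{DP}_n$ be the partial identity with domain $\{1,\dots,n\}\setminus\{n-i\}$. Let $C=\{h,x_n\}\cup\{x_i\mid 1\le i\le m\}$. Let $V$ be the following set of monoid relations over the alphabet $C$: * $x_i^2=x_i$ for $1\le i\le m$; * $x_ix_j=x_jx_i$ for $1\le i<j\le m$; * $x_ihx_{n-j-1}h=hx_{n-j-1}hx_i$ for $1\le i\le m<j\le n-2$; * $x_nx_{i+1}=x_ix_n$ for $1\le i\le\lfloor\frac{n-3}{2}\rfloor$; * $x_nhx_{m'}h=x_mx_n$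 (only if $n\ge 4$); * $x_nhx_ih=hx_{i+1}hx_n$ for $1\le i\le\lceil\frac{n-5}{2}\rceil$; * $x_n^2hx_nh=hx_1hx_n$; * $hx_nhx_n^2=x_nx_1$; * $x_nhx_nhx_n=x_n$; * $x_n^n=x_1\cdots x_m\,h\,x_{m'}\cdots x_1\,x_nx_1h$; * $x_n^{n+1}=x_n^n$; * $h^2=1$; * $hx_{\frac{n-1}{2}}=x_{\frac{n-1}{2}}h$ (only if $n$ is odd); * $x_n^{n-1}h=x_nhx_n\,x_1\cdots x_{m'}\,h\,x_m\cdots x_1$ (the product $x_1\cdots x_{m'}$ and its reverse being empty if $m'=0$). Then $C$ consists of $\lfloor\frac{n+3}{2}\rfloor$ distinct elements and generates $\mathcal{DP}_n$, no generating set of $\mathcal{DP}_n$ has fewer elements, and $\mathcal{DP}_n$ is defined by the presentation $\langle C\mid V\rangle$: the correspondence between letters and generators induces an isomorphism from the quotient of the free monoid $C^*$ by the smallest congruence containing $V$ onto $\mathcal{DP}_n$. Moreover, $V$ consists of exactly $\frac38n^2+\frac{45}{8}$ relations if $n$ is odd, and of exactly $\frac38n^2-\frac14n+5$ relations if $n$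 is even. -/

import Mathlib

namespace PartialIsometry

/-- Partial permutations of `X_n = {1, …, n}`. The element `k : Fin n` stands for the point
`k + 1` of `X_n`; `α k = some l` means that `k` lies in the domain and is sent to `l`. -/
abbrev PartialPerm (n : ℕ) := Fin n ≃. Fin n

/-- The symmetric inverse monoid: partial permutations under composition of partial maps.
Maps are written on the right, so `α * β` means first `α`, then `β`. -/
instance symInvMonoid (n : ℕ) : Monoid (PartialPerm n) where
  mul α β := α.trans β
  one := PEquiv.refl (Fin n)
  mul_assoc α β γ := PEquiv.trans_assoc α β γ
  one_mul α := PEquiv.refl_trans α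
  mul_one α := PEquiv.trans_refl α

theorem mul_def {n : ℕ} (α β : PartialPerm n) : α * β = α.trans β := rfl

theorem one_def {n : ℕ} : (1 : PartialPerm n) = PEquiv.refl (Fin n) := rfl

/-- `α` is an isometry: `|iα - jα| = |i - j|` for all `i, j` in the domain of `α`. -/
def IsIsometry {n : ℕ} (α : PartialPerm n) : Prop :=
  ∀ i j a b : Fin n, α i = some a → α j = some b →
    |((a : ℕ) : ℤ) - ((b : ℕ) : ℤ)| = |((i : ℕ) : ℤ) - ((j : ℕ) : ℤ)|

/-- The monoid `DP_n` of all partial isometries of `{1, …, n}`. -/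
def DP (n : ℕ) : Submonoid (PartialPerm n) where
  carrier := {α | IsIsometry α}
  one_mem' := by
    intro i j a b hi hj
    rw [one_def, PEquiv.refl_apply, Option.some_inj] at hi hj
    rw [hi, hj]
  mul_mem' := by
    intro α β hα hβ i j a b hi hj
    rw [mul_def, PEquiv.trans_eq_some] at hi hj
    obtain ⟨c, hic, hca⟩ := hi
    obtain ⟨d, hjd, hdb⟩ := hj
    exact (hβ c d a b hca hdb).trans (hα i j c d hic hjd)

theorem mem_DP {n : ℕ} {α : PartialPerm n} : α ∈ DP n ↔ IsIsometry α := Iff.rfl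

/-- The permutation `h : k ↦ n + 1 - k` of `{1, …, n}`. -/
def hMap (n : ℕ) : PartialPerm n := (Fin.revPerm (n := n)).toPEquiv

/-- The partial map `x_n : k ↦ k - 1` with domain `{2, …, n}`. -/
def shiftMap (n : ℕ) : PartialPerm n where
  toFun k := if (k : ℕ) = 0 then none else some ⟨(k : ℕ) - 1, by omega⟩
  invFun l := if hl : (l : ℕ) + 1 < n then some ⟨(l : ℕ) + 1, hl⟩ else none
  inv k l := by
    have hk := k.isLt
    have hl := l.isLt
    by_cases h1 : (l : ℕ) + 1 < n <;> by_cases h2 : (k : ℕ) = 0 <;>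
      simp [h1, h2, Fin.ext_iff] <;> omega

/-- The partial identity `x_i` of `{1, …, n}` with domain `{1, …, n} \ {n - i}`
(used for `1 ≤ i ≤ n - 2`). -/
def idemMap (n i : ℕ) : PartialPerm n := PEquiv.ofSet {k : Fin n | (k : ℕ) + 1 ≠ n - i}

theorem hMap_mem (n : ℕ) : hMap n ∈ DP n := by
  intro i j a b hi hj
  simp only [hMap, Equiv.toPEquiv_apply, Option.some_inj] at hi hj
  subst hi hj
  have h1 := i.isLt
  have h2 := j.isLt
  simp only [Fin.revPerm_apply, Fin.val_rev]
  rw [abs_sub_comm ((i : ℕ) : ℤ)]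
  congr 1
  omega

theorem shiftMap_mem (n : ℕ) : shiftMap n ∈ DP n := by
  intro i j a b hi hj
  change (if (i : ℕ) = 0 then none else some _) = some a at hi
  change (if (j : ℕ) = 0 then none else some _) = some b at hj
  split_ifs at hi hj with h1 h2
  rw [Option.some_inj] at hi hj
  subst hi hj
  congr 1
  simp only
  omega

theorem idemMap_mem (n i : ℕ) : idemMap n i ∈ DP n := by
  intro k l a b hk hl
  rw [idemMap, PEquiv.ofSet_eq_some_iff] at hk hl
  rw [hk.1, hl.1]

/-- The alphabet `C = {h, x_n} ∪ {x_i | 1 ≤ i ≤ ⌊(n-1)/2⌋}`.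
The letter `x i`, with `i : Fin ⌊(n-1)/2⌋`, is `x_{i+1}`. -/
inductive Letter (n : ℕ) : Type
  | h : Letter n
  | xn : Letter n
  | x (i : Fin ((n - 1) / 2)) : Letter n

/-- The element of `DP_n` named by a letter of `C`. -/
def gen (n : ℕ) : Letter n → DP n
  | .h => ⟨hMap n, hMap_mem n⟩
  | .xn => ⟨shiftMap n, shiftMap_mem n⟩
  | .x i => ⟨idemMap n ((i : ℕ) + 1), idemMap_mem n ((i : ℕ) + 1)⟩

/-- Words over `C`. -/
abbrev Word (n : ℕ) := FreeMonoid (Letter n)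

/-- The one-letter word `h`. -/
def H (n : ℕ) : Word n := FreeMonoid.of Letter.h

/-- The one-letter word `x_n`. -/
def XN (n : ℕ) : Word n := FreeMonoid.of Letter.xn

/-- The one-letter word `x_i` for `1 ≤ i ≤ ⌊(n-1)/2⌋`. The value `1` for other `i` is a
placeholder, never used in the relations below when `3 ≤ n`. -/
def X (n i : ℕ) : Word n :=
  if hi : 1 ≤ i ∧ i ≤ (n - 1) / 2 then FreeMonoid.of (Letter.x ⟨i - 1, by omega⟩) else 1

/-- The word `x_1 x_2 ⋯ x_k` (empty for `k = 0`). -/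
def ascWord (n k : ℕ) : Word n := ((List.range k).map fun t => X n (t + 1)).prod

/-- The word `x_k ⋯ x_2 x_1` (empty for `k = 0`). -/
def descWord (n k : ℕ) : Word n := ((List.range k).reverse.map fun t => X n (t + 1)).prod

/-- The relations `V` over the alphabet `C`; `Relations n u v` says that `u = v` is one of them.
For `3 ≤ n`, in natural number arithmetic, `(n - 1) / 2 = ⌊(n-1)/2⌋`, `(n - 3) / 2 = ⌊(n-3)/2⌋`,
`(n - 2) / 2 = ⌈(n-3)/2⌉` and `(n - 4) / 2 = max 0 ⌈(n-5)/2⌉`. -/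
inductive Relations (n : ℕ) : Word n → Word n → Prop
  /-- `x_i² = x_i`, `1 ≤ i ≤ ⌊(n-1)/2⌋` -/
  | idem (i : ℕ) (h1 : 1 ≤ i) (h2 : i ≤ (n - 1) / 2) :
      Relations n (X n i ^ 2) (X n i)
  /-- `x_i x_j = x_j x_i`, `1 ≤ i < j ≤ ⌊(n-1)/2⌋` -/
  | comm (i j : ℕ) (h1 : 1 ≤ i) (h2 : i < j) (h3 : j ≤ (n - 1) / 2) :
      Relations n (X n i * X n j) (X n j * X n i)
  /-- `x_i h x_{n-j-1} h = h x_{n-j-1} h x_i`, `1 ≤ i ≤ ⌊(n-1)/2⌋ < j ≤ n-2` -/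
  | commConj (i j : ℕ) (h1 : 1 ≤ i) (h2 : i ≤ (n - 1) / 2) (h3 : (n - 1) / 2 < j)
      (h4 : j ≤ n - 2) :
      Relations n (X n i * H n * X n (n - j - 1) * H n) (H n * X n (n - j - 1) * H n * X n i)
  /-- `x_n x_{i+1} = x_i x_n`, `1 ≤ i ≤ ⌊(n-3)/2⌋` -/
  | shift (i : ℕ) (h1 : 1 ≤ i) (h2 : i ≤ (n - 3) / 2) :
      Relations n (XN n * X n (i + 1)) (X n i * XN n)
  /-- `x_n h x_{⌈(n-3)/2⌉} h = x_{⌊(n-1)/2⌋} x_n`, if `n ≥ 4` -/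
  | shiftMid (h1 : 4 ≤ n) :
      Relations n (XN n * H n * X n ((n - 2) / 2) * H n) (X n ((n - 1) / 2) * XN n)
  /-- `x_n h x_i h = h x_{i+1} h x_n`, `1 ≤ i ≤ ⌈(n-5)/2⌉` -/
  | shiftConj (i : ℕ) (h1 : 1 ≤ i) (h2 : i ≤ (n - 4) / 2) :
      Relations n (XN n * H n * X n i * H n) (H n * X n (i + 1) * H n * XN n)
  /-- `x_n² h x_n h = h x_1 h x_n` -/
  | rel7 : Relations n (XN n ^ 2 * H n * XN n * H n) (H n * X n 1 * H n * XN n)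
  /-- `h x_n h x_n² = x_n x_1` -/
  | rel8 : Relations n (H n * XN n * H n * XN n ^ 2) (XN n * X n 1)
  /-- `x_n h x_n h x_n = x_n` -/
  | rel10 : Relations n (XN n * H n * XN n * H n * XN n) (XN n)
  /-- `x_n^n = x_1 ⋯ x_{⌊(n-1)/2⌋} h x_{⌈(n-3)/2⌉} ⋯ x_1 x_n x_1 h` -/
  | rel11 : Relations n (XN n ^ n)
      (ascWord n ((n - 1) / 2) * H n * descWord n ((n - 2) / 2) * XN n * X n 1 * H n)
  /-- `x_n^{n+1} = x_n^n` -/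
  | rel12 : Relations n (XN n ^ (n + 1)) (XN n ^ n)
  /-- `h² = 1` -/
  | invol : Relations n (H n ^ 2) 1
  /-- `h x_{(n-1)/2} = x_{(n-1)/2} h`, if `n` is odd -/
  | central (h1 : Odd n) :
      Relations n (H n * X n ((n - 1) / 2)) (X n ((n - 1) / 2) * H n)
  /-- `x_n^{n-1} h = x_n h x_n x_1 ⋯ x_{⌈(n-3)/2⌉} h x_{⌊(n-1)/2⌋} ⋯ x_1` -/
  | rank1 : Relations n (XN n ^ (n - 1) * H n)
      (XN n * H n * XN n * ascWord n ((n - 2) / 2) * H n * descWord n ((n - 1) / 2))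

/-- `V` as a set of pairs of words, so that its elements can be counted. -/
def relationSet (n : ℕ) : Set (Word n × Word n) := {p | Relations n p.1 p.2}

end PartialIsometry

/-! A partial permutation is treated as an integer function restricted to a set of integers, so
checking the relations in `DP n` is linear arithmetic on domains and formulas
(`val_eq_of_relations`).

For the converse, the presented monoid contains an element `idemElt n k` for the partial identity
missing `k`. The relations make these commuting idempotents, which `h` reflects and `x_n` shifts
(`frame`). Hence every element is a product of idempotents, times a power of the shift or of its
inverse `h x_n h`, times `h` or `1` (`exists_presForm`). The exponent and the presence of `h` are
determined by the map only if it has rank at least two. A map of rank one is a restriction of both a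
translation and a reflection, and the empty map of all of them; the relations for `x_n^(n-1) h`,
`x_n^n` and `x_n^(n+1)` identify these forms (`fullFrame`). So normal forms with the same action are
equal (`FullFrame.normalForm_congr`), which gives injectivity. Surjectivity holds because a partial
isometry is a restriction of a translation or of a reflection (`exists_image`).

For minimality, the only total elements are `1` and `h`. So a generating set must contain `h` and,
for each pair `{p, n + 1 - p}`, an element missing exactly one point, taken from that pair. The
relations are counted by their parameters, because their left-hand sides are pairwise distinct
words. -/

namespace PartialIsometry

/-! ### Partial permutations as restricted integer functions -/

/-- The graph of a partial permutation, in terms of the points `1, …, n`. -/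
def Graph {n : ℕ} (α : PartialPerm n) (a b : ℤ) : Prop :=
  ∃ i j : Fin n, (i : ℤ) + 1 = a ∧ (j : ℤ) + 1 = b ∧ α i = some j

theorem graph_mul {n : ℕ} (α β : PartialPerm n) (a b : ℤ) :
    Graph (α * β) a b ↔ ∃ c, Graph α a c ∧ Graph β c b := by
  constructor
  · rintro ⟨i, j, hi, hj, h⟩
    rw [mul_def, PEquiv.trans_eq_some] at h
    obtain ⟨c, hc, hc'⟩ := h
    exact ⟨c + 1, ⟨i, c, hi, rfl, hc⟩, ⟨c, j, rfl, hj, hc'⟩⟩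
  · rintro ⟨c, ⟨i, k, hi, hk, h⟩, ⟨k', j, hk', hj, h'⟩⟩
    have : k = k' := by ext; omega
    subst this
    exact ⟨i, j, hi, hj, (PEquiv.trans_eq_some ..).2 ⟨k, h, h'⟩⟩

theorem graph_ext {n : ℕ} {α β : PartialPerm n} (h : ∀ a b, Graph α a b ↔ Graph β a b) :
    α = β := by
  have key : ∀ {α β : PartialPerm n}, (∀ a b, Graph α a b → Graph β a b) →
      ∀ i j, α i = some j → β i = some j := by
    intro α β h i j hij
    obtain ⟨i', j', hi, hj, h'⟩ := h _ _ ⟨i, j, rfl, rfl, hij⟩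
    have e1 : i' = i := by ext; omega
    have e2 : j' = j := by ext; omega
    rwa [e1, e2] at h'
  refine PEquiv.ext fun i => Option.ext fun j => ⟨?_, ?_⟩
  · exact key (fun a b => (h a b).1) i j
  · exact key (fun a b => (h a b).2) i j

theorem Graph.bounds {n : ℕ} {α : PartialPerm n} {a b : ℤ} (h : Graph α a b) :
    (1 ≤ a ∧ a ≤ n) ∧ 1 ≤ b ∧ b ≤ n := by
  obtain ⟨i, j, hi, hj, -⟩ := h
  omega

theorem Graph.unique {n : ℕ} {α : PartialPerm n} {a b b' : ℤ} (h : Graph α a b)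
    (h' : Graph α a b') : b = b' := by
  obtain ⟨i, j, hi, hj, hij⟩ := h
  obtain ⟨i', j', hi', hj', hij'⟩ := h'
  have : i = i' := by ext; omega
  subst this
  rw [hij, Option.some_inj] at hij'
  subst hij'
  omega

theorem graph_one {n : ℕ} (a b : ℤ) :
    Graph (1 : PartialPerm n) a b ↔ (1 ≤ a ∧ a ≤ n) ∧ b = a := by
  constructor
  · rintro ⟨i, j, hi, hj, h⟩
    rw [one_def, PEquiv.refl_apply, Option.some_inj] at h
    subst h
    omega
  · rintro ⟨⟨h1, h2⟩, rfl⟩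
    have e : (((⟨(b - 1).toNat, by omega⟩ : Fin n) : ℕ) : ℤ) + 1 = b := by
      simp only; omega
    exact ⟨_, _, e, e, by rw [one_def, PEquiv.refl_apply]⟩

theorem graph_hMap {n : ℕ} (a b : ℤ) :
    Graph (hMap n) a b ↔ (1 ≤ a ∧ a ≤ n) ∧ b = n + 1 - a := by
  constructor
  · rintro ⟨i, j, hi, hj, h⟩
    simp only [hMap, Equiv.toPEquiv_apply, Option.some_inj, Fin.revPerm_apply] at h
    subst h
    rw [Fin.val_rev] at hj
    omega
  · rintro ⟨⟨h1, h2⟩, rfl⟩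
    refine ⟨⟨(a - 1).toNat, by omega⟩, Fin.rev ⟨(a - 1).toNat, by omega⟩, ?_, ?_, ?_⟩
    · simp only; omega
    · simp only [Fin.val_rev]; omega
    · simp [hMap]

theorem graph_shiftMap {n : ℕ} (a b : ℤ) :
    Graph (shiftMap n) a b ↔ (2 ≤ a ∧ a ≤ n) ∧ b = a - 1 := by
  constructor
  · rintro ⟨i, j, hi, hj, h⟩
    change (if (i : ℕ) = 0 then none else some _) = some j at h
    split_ifs at h with h0
    rw [Option.some_inj] at h
    subst h
    simp only at hj
    omega
  · rintro ⟨⟨h1, h2⟩, rfl⟩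
    refine ⟨⟨(a - 1).toNat, by omega⟩, ⟨(a - 2).toNat, by omega⟩, ?_, ?_, ?_⟩
    · simp only; omega
    · simp only; omega
    · change (if _ = 0 then none else some _) = some _
      rw [if_neg (by simp only; omega), Option.some_inj, Fin.mk.injEq]
      simp only
      omega

theorem graph_idemMap {n : ℕ} (i : ℕ) (hi : i ≤ n) (a b : ℤ) :
    Graph (idemMap n i) a b ↔ (1 ≤ a ∧ a ≤ n ∧ a ≠ n - i) ∧ b = a := by
  constructor
  · rintro ⟨k, j, hk, hj, h⟩
    rw [idemMap, PEquiv.ofSet_eq_some_iff] at h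
    obtain ⟨rfl, h⟩ := h
    simp only [Set.mem_ofPred_eq] at h
    omega
  · rintro ⟨⟨h1, h2, h3⟩, rfl⟩
    have e : (((⟨(b - 1).toNat, by omega⟩ : Fin n) : ℕ) : ℤ) + 1 = b := by
      simp only; omega
    refine ⟨_, _, e, e, ?_⟩
    rw [idemMap, PEquiv.ofSet_eq_some_iff]
    refine ⟨rfl, ?_⟩
    simp only [Set.mem_ofPred_eq]
    omega

/-- `α` is the restriction of `f` to the points satisfying `P`. -/
def Acts {n : ℕ} (α : PartialPerm n) (P : ℤ → Prop) (f : ℤ → ℤ) : Prop :=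
  ∀ a b, Graph α a b ↔ P a ∧ b = f a

theorem Acts.mul {n : ℕ} {α β : PartialPerm n} {P Q : ℤ → Prop} {f g : ℤ → ℤ}
    (h1 : Acts α P f) (h2 : Acts β Q g) :
    Acts (α * β) (fun a => P a ∧ Q (f a)) (fun a => g (f a)) := by
  intro a b
  rw [graph_mul]
  constructor
  · rintro ⟨c, hc, hc'⟩
    obtain ⟨hp, rfl⟩ := (h1 _ _).1 hc
    obtain ⟨hq, rfl⟩ := (h2 _ _).1 hc'
    exact ⟨⟨hp, hq⟩, rfl⟩
  · rintro ⟨⟨hp, hq⟩, rfl⟩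
    exact ⟨f a, (h1 _ _).2 ⟨hp, rfl⟩, (h2 _ _).2 ⟨hq, rfl⟩⟩

theorem Acts.congr {n : ℕ} {α : PartialPerm n} {P Q : ℤ → Prop} {f g : ℤ → ℤ}
    (h : Acts α P f) (hP : ∀ a, Q a ↔ P a) (hf : ∀ a, P a → g a = f a) : Acts α Q g := by
  intro a b
  rw [h a b, hP]
  exact and_congr_right fun hp => by rw [hf a hp]

/-- Reduces an equation between products of generators to a comparison of domains and formulas,
usually within reach of `omega`. -/
theorem Acts.eq {n : ℕ} {α β : PartialPerm n} {P Q : ℤ → Prop} {f g : ℤ → ℤ}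
    (h1 : Acts α P f) (h2 : Acts β Q g) (hP : ∀ a, P a ↔ Q a) (hf : ∀ a, P a → f a = g a) :
    α = β :=
  graph_ext fun a b => by
    rw [h1 a b, h2.congr hP (fun a ha => hf a ((hP a).2 ha)) a b]

theorem acts_one {n : ℕ} : Acts (1 : PartialPerm n) (fun a => 1 ≤ a ∧ a ≤ n) (fun a => a) :=
  graph_one

/-- The partial permutation named by a word. -/
def val (n : ℕ) : Word n →* PartialPerm n := (DP n).subtype.comp (FreeMonoid.lift (gen n))

theorem acts_H {n : ℕ} :
    Acts (val n (H n)) (fun a => 1 ≤ a ∧ a ≤ n) (fun a => n + 1 - a) :=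
  graph_hMap

theorem acts_XN {n : ℕ} : Acts (val n (XN n)) (fun a => 2 ≤ a ∧ a ≤ n) (fun a => a - 1) :=
  graph_shiftMap

theorem acts_X {n i : ℕ} (h1 : 1 ≤ i) (h2 : i ≤ (n - 1) / 2) :
    Acts (val n (X n i)) (fun a => 1 ≤ a ∧ a ≤ n ∧ a ≠ n - i) (fun a => a) := by
  have : val n (X n i) = idemMap n i := by
    rw [X, dif_pos ⟨h1, h2⟩]
    change idemMap n (i - 1 + 1) = _
    rw [Nat.sub_add_cancel h1]
  rw [this]
  exact graph_idemMap i (by omega)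

theorem acts_XN_pow {n : ℕ} (k : ℕ) :
    Acts (val n (XN n ^ k)) (fun a => k < a ∧ 1 ≤ a ∧ a ≤ n) (fun a => a - k) := by
  induction k with
  | zero =>
    rw [pow_zero, map_one]
    exact acts_one.congr (fun a => by simp; omega) (fun a _ => by simp)
  | succ k ih =>
    rw [pow_succ, map_mul]
    exact (ih.mul acts_XN).congr (fun a => by push_cast; omega) (fun a _ => by push_cast; omega)

theorem acts_list {n : ℕ} (l : List ℕ) (hl : ∀ t ∈ l, t + 1 ≤ (n - 1) / 2) :
    Acts (val n (l.map fun t => X n (t + 1)).prod)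
      (fun a => 1 ≤ a ∧ a ≤ n ∧ ∀ t ∈ l, a ≠ n - (t + 1)) (fun a => a) := by
  induction l with
  | nil => simpa using acts_one
  | cons t l ih =>
    rw [List.map_cons, List.prod_cons, map_mul]
    refine ((acts_X (by omega) (hl t (by simp))).mul
      (ih fun s hs => hl s (List.mem_cons_of_mem _ hs))).congr (fun a => ?_) (fun a _ => rfl)
    simp only [List.forall_mem_cons]
    push_cast
    tauto

theorem acts_ascWord {n k : ℕ} (hk : k ≤ (n - 1) / 2) :
    Acts (val n (ascWord n k)) (fun a => 1 ≤ a ∧ a ≤ n ∧ (a < n - k ∨ n - 1 < a))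
      (fun a => a) := by
  refine (acts_list (List.range k) fun t ht => ?_).congr (fun a => ?_) (fun a _ => rfl)
  · rw [List.mem_range] at ht; omega
  · simp only [List.mem_range]
    refine and_congr_right fun h1 => and_congr_right fun h2 => ⟨fun h t ht => by omega, fun h => ?_⟩
    by_contra hc
    -- The index `t` whose factor `x_{t+1}` removes the point `a = n - (t + 1)`.
    exact h (n - 1 - a).toNat (by omega) (by omega)

theorem acts_descWord {n k : ℕ} (hk : k ≤ (n - 1) / 2) :
    Acts (val n (descWord n k)) (fun a => 1 ≤ a ∧ a ≤ n ∧ (a < n - k ∨ n - 1 < a))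
      (fun a => a) := by
  refine (acts_list (List.range k).reverse fun t ht => ?_).congr (fun a => ?_) (fun a _ => rfl)
  · rw [List.mem_reverse, List.mem_range] at ht; omega
  · simp only [List.mem_reverse, List.mem_range]
    refine and_congr_right fun h1 => and_congr_right fun h2 => ⟨fun h t ht => by omega, fun h => ?_⟩
    by_contra hc
    exact h (n - 1 - a).toNat (by omega) (by omega)

/-! ### Soundness of the relations -/

/-- The relations hold in `DP_n`. -/
theorem val_eq_of_relations {n : ℕ} (hn : 3 ≤ n) {u v : Word n} (h : Relations n u v) :
    val n u = val n v := by
  cases h with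
  | idem i h1 h2 =>
    rw [pow_two, map_mul]
    exact ((acts_X h1 h2).mul (acts_X h1 h2)).eq (acts_X h1 h2) (fun a => by omega)
      (fun a _ => rfl)
  | comm i j h1 h2 h3 =>
    have hi := acts_X h1 (h2.le.trans h3)
    have hj := acts_X (h1.trans h2.le) h3
    simp only [map_mul]
    exact (hi.mul hj).eq (hj.mul hi) (fun a => by omega) (fun a _ => rfl)
  | commConj i j h1 h2 h3 h4 =>
    have hi := acts_X h1 h2
    have hj := acts_X (n := n) (i := n - j - 1) (by omega) (by omega)
    simp only [map_mul]
    exact (((hi.mul acts_H).mul hj).mul acts_H).eq (((acts_H.mul hj).mul acts_H).mul hi)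
      (fun a => by omega) (fun a _ => by omega)
  | shift i h1 h2 =>
    have hi := acts_X (n := n) (i := i) h1 (by omega)
    have hj := acts_X (n := n) (i := i + 1) (by omega) (by omega)
    simp only [map_mul]
    exact (acts_XN.mul hj).eq (hi.mul acts_XN) (fun a => by omega) (fun a _ => by omega)
  | shiftMid h1 =>
    have hi := acts_X (n := n) (i := (n - 2) / 2) (by omega) (by omega)
    have hj := acts_X (n := n) (i := (n - 1) / 2) (by omega) (by omega)
    simp only [map_mul]
    exact (((acts_XN.mul acts_H).mul hi).mul acts_H).eq (hj.mul acts_XN)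
      (fun a => by omega) (fun a _ => by omega)
  | shiftConj i h1 h2 =>
    have hi := acts_X (n := n) (i := i) h1 (by omega)
    have hj := acts_X (n := n) (i := i + 1) (by omega) (by omega)
    simp only [map_mul]
    exact (((acts_XN.mul acts_H).mul hi).mul acts_H).eq
      (((acts_H.mul hj).mul acts_H).mul acts_XN) (fun a => by omega) (fun a _ => by omega)
  | rel7 =>
    have h1 := acts_X (n := n) (i := 1) le_rfl (by omega)
    rw [pow_two]
    simp only [map_mul]
    exact ((((acts_XN.mul acts_XN).mul acts_H).mul acts_XN).mul acts_H).eq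
      (((acts_H.mul h1).mul acts_H).mul acts_XN) (fun a => by omega) (fun a _ => by omega)
  | rel8 =>
    have h1 := acts_X (n := n) (i := 1) le_rfl (by omega)
    rw [pow_two]
    simp only [map_mul]
    exact (((acts_H.mul acts_XN).mul acts_H).mul (acts_XN.mul acts_XN)).eq
      (acts_XN.mul h1) (fun a => by omega) (fun a _ => by omega)
  | rel10 =>
    simp only [map_mul]
    exact ((((acts_XN.mul acts_H).mul acts_XN).mul acts_H).mul acts_XN).eq
      acts_XN (fun a => by omega) (fun a _ => by omega)
  | rel11 =>
    have h1 := acts_X (n := n) (i := 1) le_rfl (by omega)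
    have ha := acts_ascWord (n := n) (k := (n - 1) / 2) le_rfl
    have hd := acts_descWord (n := n) (k := (n - 2) / 2) (by omega)
    simp only [map_mul (val n) (_ * _), map_mul (val n) (ascWord _ _)]
    exact (acts_XN_pow n).eq (((((ha.mul acts_H).mul hd).mul acts_XN).mul h1).mul acts_H)
      (fun a => by omega) (fun a _ => by omega)
  | rel12 =>
    exact (acts_XN_pow (n + 1)).eq (acts_XN_pow n) (fun a => by push_cast; omega)
      (fun a _ => by omega)
  | invol =>
    rw [pow_two, map_mul, map_one]
    exact (acts_H.mul acts_H).eq acts_one (fun a => by omega) (fun a _ => by omega)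
  | central ho =>
    obtain ⟨k, rfl⟩ := ho
    have h1 := acts_X (n := 2 * k + 1) (i := (2 * k + 1 - 1) / 2) (by omega) le_rfl
    simp only [map_mul]
    exact (acts_H.mul h1).eq (h1.mul acts_H) (fun a => by omega) (fun a _ => by omega)
  | rank1 =>
    have ha := acts_ascWord (n := n) (k := (n - 2) / 2) (by omega)
    have hd := acts_descWord (n := n) (k := (n - 1) / 2) le_rfl
    simp only [map_mul (val n) (_ * _), map_mul (val n) (XN n), map_mul (val n) (XN n ^ (n - 1))]
    exact ((acts_XN_pow (n - 1)).mul acts_H).eq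
      (((((acts_XN.mul acts_H).mul acts_XN).mul ha).mul acts_H).mul hd)
      (fun a => by omega) (fun a _ => by omega)

/-! ### Calculus of idempotents and shifts in an abstract monoid -/

/-- Elements `h`, `x` and `e k` (`k ∈ ℤ`) of a monoid that multiply like the reflection, the
shift and the partial identities missing `k` of `{1, …, n}`. -/
structure Frame {M : Type*} [Monoid M] (n : ℕ) (h x : M) (e : ℤ → M) : Prop where
  h_sq : h * h = 1
  h_e : ∀ k, h * e k = e (n + 1 - k) * h
  x_e : ∀ k, x * e k = e (k + 1) * x
  e_one : e 1 = x * (h * x * h)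
  -- With this convention `x_e` needs no bounds: at `k = 0` and `k = n` it says that `x` absorbs `e
  -- 1` on the left and `e n` on the right.
  e_out : ∀ k : ℤ, k < 1 ∨ n < k → e k = 1
  e_sq : ∀ k, e k * e k = e k
  e_comm : ∀ j k, e j * e k = e k * e j

/-- The product of the `e k`, for `k` in a list. -/
def listProd {M : Type*} [Monoid M] (e : ℤ → M) (l : List ℤ) : M := (l.map e).prod

/-- The integers `1, …, n` satisfying `p`. -/
def pointList (n : ℕ) (p : ℤ → Bool) : List ℤ :=
  ((List.range n).map fun i : ℕ => (i : ℤ) + 1).filter p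

theorem mem_pointList {n : ℕ} {p : ℤ → Bool} {a : ℤ} :
    a ∈ pointList n p ↔ (1 ≤ a ∧ a ≤ n) ∧ p a := by
  rw [pointList, List.mem_filter, List.mem_map]
  refine and_congr_left fun _ => ⟨?_, fun h => ⟨(a - 1).toNat, ?_, by omega⟩⟩
  · rintro ⟨i, hi, rfl⟩
    rw [List.mem_range] at hi
    omega
  · rw [List.mem_range]
    omega

/-- The power of the shift `x`, or of its inverse `h * x * h`, that moves each `a` to `a - k`. -/
def shiftPow {M : Type*} [Monoid M] (h x : M) (k : ℤ) : M :=
  if 0 ≤ k then x ^ k.toNat else (h * x * h) ^ (-k).toNat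

section
variable {M : Type*} [Monoid M] {n : ℕ} {h x : M} {e : ℤ → M}

theorem listProd_nil : listProd e [] = 1 := rfl

theorem listProd_cons (k : ℤ) (l : List ℤ) : listProd e (k :: l) = e k * listProd e l := by
  simp [listProd]

theorem listProd_append (l l' : List ℤ) :
    listProd e (l ++ l') = listProd e l * listProd e l' := by
  simp [listProd]

theorem shiftPow_natCast (k : ℕ) : shiftPow h x k = x ^ k := by
  simp [shiftPow]

theorem shiftPow_neg_natCast (k : ℕ) : shiftPow h x (-k) = (h * x * h) ^ k := by
  rcases Nat.eq_zero_or_pos k with rfl | hk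
  · simp [shiftPow]
  · rw [shiftPow, if_neg (by omega)]
    simp

namespace Frame

theorem h_h (F : Frame n h x e) (a : M) : h * (h * a) = a := by
  rw [← mul_assoc, F.h_sq, one_mul]

theorem y_e (F : Frame n h x e) (k : ℤ) : h * x * h * e (k + 1) = e k * (h * x * h) := by
  rw [mul_assoc, F.h_e, mul_assoc h x, ← mul_assoc x, F.x_e, ← mul_assoc, ← mul_assoc, F.h_e]
  rw [show (n : ℤ) + 1 - (n + 1 - (k + 1) + 1) = k by ring]
  simp only [mul_assoc]

theorem e_last (F : Frame n h x e) : e n = h * x * h * x := by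
  have h1 := F.h_e 1
  rw [show (n : ℤ) + 1 - 1 = n by ring, F.e_one] at h1
  calc e n = e n * h * h := by rw [mul_assoc, F.h_sq, mul_one]
    _ = _ := by rw [← h1]; simp only [mul_assoc, F.h_sq, mul_one]

theorem e_zero (F : Frame n h x e) : e 0 = 1 := F.e_out 0 (by omega)

theorem listProd_absorb (F : Frame n h x e) {k : ℤ} {l : List ℤ} (hk : k ∈ l) :
    listProd e l * e k = listProd e l := by
  induction l with
  | nil => simp at hk
  | cons a l ih =>
    rw [listProd_cons, mul_assoc]
    by_cases hl : k ∈ l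
    · rw [ih hl]
    · obtain rfl : k = a := by simpa [hl] using hk
      have : ∀ l : List ℤ, Commute (listProd e l) (e k) := fun l =>
        Commute.list_prod_left _ _ (by
          intro y hy
          obtain ⟨j, -, rfl⟩ := List.mem_map.1 hy
          exact F.e_comm _ _)
      rw [(this l).eq, ← mul_assoc, F.e_sq]

theorem listProd_comm (F : Frame n h x e) (l l' : List ℤ) :
    listProd e l * listProd e l' = listProd e l' * listProd e l := by
  refine (Commute.list_prod_left _ _ fun y hy => Commute.list_prod_right _ _ fun z hz => ?_).eq
  obtain ⟨j, -, rfl⟩ := List.mem_map.1 hy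
  obtain ⟨k, -, rfl⟩ := List.mem_map.1 hz
  exact F.e_comm _ _

theorem listProd_mul_of_subset (F : Frame n h x e) {l l' : List ℤ}
    (hl : ∀ k : ℤ, 1 ≤ k → k ≤ n → k ∈ l' → k ∈ l) :
    listProd e l * listProd e l' = listProd e l := by
  induction l' with
  | nil => rw [listProd_nil, mul_one]
  | cons a l' ih =>
    have ha : listProd e l * e a = listProd e l := by
      by_cases h1 : 1 ≤ a ∧ a ≤ n
      · exact F.listProd_absorb (hl a h1.1 h1.2 (by simp))
      · rw [F.e_out a (by omega), mul_one]
    rw [listProd_cons, ← mul_assoc, ha]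
    exact ih fun k h1 h2 h3 => hl k h1 h2 (List.mem_cons_of_mem _ h3)

/-- Each product absorbs the other, and they commute; order, repetition and points outside `1, …, n`
are therefore irrelevant. -/
theorem listProd_congr (F : Frame n h x e) {l l' : List ℤ}
    (hl : ∀ k : ℤ, 1 ≤ k → k ≤ n → (k ∈ l ↔ k ∈ l')) : listProd e l = listProd e l' := by
  rw [← F.listProd_mul_of_subset (l := l) (l' := l') fun k h1 h2 => (hl k h1 h2).2,
    F.listProd_comm, F.listProd_mul_of_subset fun k h1 h2 => (hl k h1 h2).1]

theorem h_listProd (F : Frame n h x e) (l : List ℤ) :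
    h * listProd e l = listProd e (l.map fun k => n + 1 - k) * h := by
  induction l with
  | nil => simp [listProd]
  | cons a l ih =>
    rw [List.map_cons, listProd_cons, listProd_cons, ← mul_assoc, F.h_e, mul_assoc, ih, mul_assoc]

theorem listProd_h (F : Frame n h x e) (l : List ℤ) :
    listProd e l * h = h * listProd e (l.map fun k => n + 1 - k) := by
  rw [F.h_listProd, List.map_map]
  congr 2
  simp

theorem y_y (F : Frame n h x e) : h * (h * x * h) * h = x := by
  simp only [mul_assoc, F.h_h, F.h_sq, mul_one]

theorem shiftPow_e (F : Frame n h x e) (k j : ℤ) :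
    shiftPow h x k * e j = e (j + k) * shiftPow h x k := by
  obtain ⟨k, rfl | rfl⟩ := k.eq_nat_or_neg
  · rw [shiftPow_natCast]
    induction k generalizing j with
    | zero => simp
    | succ k ih =>
      rw [pow_succ, mul_assoc, F.x_e, ← mul_assoc, ih, mul_assoc]
      push_cast
      rw [add_right_comm, add_assoc]
  · rw [shiftPow_neg_natCast]
    induction k generalizing j with
    | zero => simp
    | succ k ih =>
      have := F.y_e (j - 1)
      rw [sub_add_cancel] at this
      rw [pow_succ, mul_assoc, this, ← mul_assoc, ih, mul_assoc]
      congr 2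
      push_cast
      ring

theorem shiftPow_listProd (F : Frame n h x e) (k : ℤ) (l : List ℤ) :
    shiftPow h x k * listProd e l = listProd e (l.map fun j => j + k) * shiftPow h x k := by
  induction l with
  | nil => simp [listProd]
  | cons a l ih =>
    rw [List.map_cons, listProd_cons, listProd_cons, ← mul_assoc, F.shiftPow_e, mul_assoc, ih,
      mul_assoc]

theorem h_shiftPow (F : Frame n h x e) (k : ℤ) :
    h * shiftPow h x k = shiftPow h x (-k) * h := by
  have key : ∀ (a : M) (j : ℕ), h * a ^ j = (h * a * h) ^ j * h := by
    intro a j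
    induction j with
    | zero => simp
    | succ j ih =>
      rw [pow_succ, ← mul_assoc, ih, pow_succ]
      simp only [mul_assoc, F.h_sq, mul_one]
  obtain ⟨k, rfl | rfl⟩ := k.eq_nat_or_neg
  · rw [shiftPow_natCast, shiftPow_neg_natCast, key]
  · rw [shiftPow_neg_natCast, neg_neg, shiftPow_natCast, key, F.y_y]

/-- Exponents add up to one idempotent: for `k < 0` the last inverse shift and `x` combine to `e n`,
which is moved to the front. Otherwise nothing is lost, and the index `0` encodes the factor `1`. -/
theorem shiftPow_mul_x (F : Frame n h x e) (k : ℤ) :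
    shiftPow h x k * x = e (if k < 0 then n + k + 1 else 0) * shiftPow h x (k + 1) := by
  split_ifs with hk
  · obtain ⟨j, rfl⟩ : ∃ j : ℕ, k = -((j + 1 : ℕ) : ℤ) := ⟨(-k - 1).toNat, by omega⟩
    have e1 : -((j + 1 : ℕ) : ℤ) + 1 = -(j : ℤ) := by push_cast; ring
    rw [e1, show (n : ℤ) + -((j + 1 : ℕ) : ℤ) + 1 = n + -(j : ℤ) by push_cast; ring,
      ← F.shiftPow_e, shiftPow_neg_natCast, shiftPow_neg_natCast, pow_succ, F.e_last]
    simp only [mul_assoc]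
  · lift k to ℕ using by omega
    rw [F.e_zero, one_mul, shiftPow_natCast, ← Nat.cast_succ, shiftPow_natCast, pow_succ]

theorem shiftPow_mul_y (F : Frame n h x e) (k : ℤ) :
    shiftPow h x k * (h * x * h) = e (if 0 < k then k else 0) * shiftPow h x (k - 1) := by
  split_ifs with hk
  · obtain ⟨j, rfl⟩ : ∃ j : ℕ, k = ((j + 1 : ℕ) : ℤ) := ⟨(k - 1).toNat, by omega⟩
    have e1 : ((j + 1 : ℕ) : ℤ) - 1 = (j : ℤ) := by push_cast; ring
    rw [e1, show ((j + 1 : ℕ) : ℤ) = 1 + j by push_cast; ring,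
      ← F.shiftPow_e, add_comm, ← Nat.cast_succ, shiftPow_natCast, shiftPow_natCast, pow_succ,
      F.e_one, mul_assoc]
  · obtain ⟨j, rfl⟩ : ∃ j : ℕ, k = -(j : ℤ) := ⟨(-k).toNat, by omega⟩
    rw [F.e_zero, one_mul, show -(j : ℤ) - 1 = -((j + 1 : ℕ) : ℤ) by push_cast; ring,
      shiftPow_neg_natCast, shiftPow_neg_natCast, pow_succ]

/-- If `a - k` lies outside `1, …, n`, moving `e a` past the shift turns it into `e (a - k) = 1`. So
only the points in the domain of the shift matter. -/
theorem listProd_mul_shiftPow_congr (F : Frame n h x e) {k : ℤ} {l l' : List ℤ}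
    (hl : ∀ a : ℤ, (1 ≤ a ∧ a ≤ n) ∧ 1 ≤ a - k ∧ a - k ≤ n → (a ∈ l ↔ a ∈ l')) :
    listProd e l * shiftPow h x k = listProd e l' * shiftPow h x k := by
  set b := pointList n fun a => ¬(1 ≤ a - k ∧ a - k ≤ n) with hb
  have key : listProd e b * shiftPow h x k = shiftPow h x k := by
    have hb' : ∀ a ∈ b, e a * shiftPow h x k = shiftPow h x k := by
      intro a ha
      rw [hb, mem_pointList, decide_eq_true_eq] at ha
      have := F.shiftPow_e k (a - k)
      rwa [sub_add_cancel, F.e_out (a - k) (by omega), mul_one, eq_comm] at this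
    clear_value b
    clear hb
    induction b with
    | nil => exact one_mul _
    | cons a b ih =>
      rw [listProd_cons, mul_assoc, ih fun c hc => hb' c (List.mem_cons_of_mem _ hc),
        hb' a (by simp)]
  rw [← key, ← mul_assoc, ← mul_assoc, ← listProd_append, ← listProd_append]
  congr 1
  refine F.listProd_congr fun a h1 h2 => ?_
  rw [List.mem_append, List.mem_append, hb, mem_pointList, decide_eq_true_eq]
  have := hl a
  tauto

theorem lone_mul_e (F : Frame n h x e) {p j : ℤ} (hj : j ≠ p) (a : M) :
    listProd e (pointList n (· ≠ p)) * (e j * a) = listProd e (pointList n (· ≠ p)) * a := by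
  rw [← mul_assoc]
  by_cases h1 : 1 ≤ j ∧ j ≤ n
  · rw [F.listProd_absorb]
    rw [mem_pointList]
    simpa [hj] using h1
  · rw [F.e_out j (by omega), mul_one]

/-- While the image of `p` stays within `1, …, n`, the idempotents produced by adding exponents
never have index `p`, so the product over all other points absorbs them. -/
theorem lone_shiftPow_mul_x_pow (F : Frame n h x e) {p k : ℤ} (j : ℕ) (h1 : p - k ≤ n)
    (h2 : 1 ≤ p - k - j) :
    listProd e (pointList n (· ≠ p)) * shiftPow h x k * x ^ j =
      listProd e (pointList n (· ≠ p)) * shiftPow h x (k + j) := by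
  induction j with
  | zero => simp
  | succ j ih =>
    rw [pow_succ, ← mul_assoc, ih (by push_cast at h2; omega), mul_assoc, F.shiftPow_mul_x,
      F.lone_mul_e, Nat.cast_succ, add_assoc]
    push_cast at h2
    split_ifs <;> omega

theorem lone_shiftPow_mul_y_pow (F : Frame n h x e) {p k : ℤ} (j : ℕ) (h1 : 1 ≤ p - k)
    (h2 : p - k + j ≤ n) (hp : 1 ≤ p) :
    listProd e (pointList n (· ≠ p)) * shiftPow h x k * (h * x * h) ^ j =
      listProd e (pointList n (· ≠ p)) * shiftPow h x (k - j) := by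
  induction j with
  | zero => simp
  | succ j ih =>
    rw [pow_succ, ← mul_assoc, ih (by push_cast at h2; omega), mul_assoc, F.shiftPow_mul_y,
      F.lone_mul_e, Nat.cast_succ, sub_sub]
    push_cast at h2
    split_ifs <;> omega

end Frame

/-! ### Maps of rank zero and one -/

/-- A frame in which the products of `n` and of `n - 1` distinct `e k` multiply like the maps of
rank zero and one. -/
structure FullFrame (n : ℕ) (h x : M) (e : ℤ → M) : Prop extends Frame n h x e where
  x_pow : x ^ n = listProd e (pointList n fun _ => true) * (h * x * h)
  x_pow_succ : x ^ (n + 1) = x ^ n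
  x_pow_pred : x ^ (n - 1) * h = listProd e (pointList n (· ≠ (n : ℤ)))

namespace FullFrame

theorem all_mul_e (F : FullFrame n h x e) (k : ℤ) :
    listProd e (pointList n fun _ => true) * e k = listProd e (pointList n fun _ => true) := by
  by_cases h1 : 1 ≤ k ∧ k ≤ n
  · exact F.listProd_absorb (by simpa [mem_pointList] using h1)
  · rw [F.e_out k (by omega), mul_one]

/-- Since `x ^ n = x ^ (n + 1)`, the factor `h * x * h` in `x_pow` may be multiplied by `x`, which
makes it `e n`, and this is absorbed. -/
theorem all_eq (F : FullFrame n h x e) : listProd e (pointList n fun _ => true) = x ^ n := by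
  rw [← F.x_pow_succ, pow_succ, F.x_pow, mul_assoc, ← F.e_last, F.all_mul_e]

theorem all_mul_x (F : FullFrame n h x e) :
    listProd e (pointList n fun _ => true) * x = listProd e (pointList n fun _ => true) := by
  rw [F.all_eq, ← pow_succ, F.x_pow_succ]

theorem all_mul_y (F : FullFrame n h x e) :
    listProd e (pointList n fun _ => true) * (h * x * h) =
      listProd e (pointList n fun _ => true) := by
  rw [← F.x_pow, F.all_eq]

theorem all_mul_h (F : FullFrame n h x e) (hn : 1 ≤ n) :
    listProd e (pointList n fun _ => true) * h = listProd e (pointList n fun _ => true) := by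
  have h1 : listProd e (pointList n fun _ => true) =
      listProd e (pointList n (· ≠ (n : ℤ))) * e n := by
    have : e n = listProd e [(n : ℤ)] := by simp [listProd]
    rw [this, ← listProd_append]
    refine F.listProd_congr fun k h1 h2 => ?_
    simp only [mem_pointList, List.mem_append, List.mem_singleton, decide_eq_true_eq, and_true]
    omega
  have h2 : x ^ (n - 1) * (x * (h * x * h)) = listProd e (pointList n fun _ => true) := by
    rw [← mul_assoc, ← pow_succ, Nat.sub_add_cancel hn, ← F.all_eq, F.all_mul_y]
  -- Moving `e n` past `h` gives `x ^ (n - 1) * e 1 * h`, where `x ^ (n - 1) * e 1` is again the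
  -- full product.
  conv_rhs => rw [h1, ← F.x_pow_pred, mul_assoc, F.h_e, ← mul_assoc,
    show (n : ℤ) + 1 - n = 1 by ring, F.e_one, h2]

theorem all_mul_shiftPow (F : FullFrame n h x e) (k : ℤ) :
    listProd e (pointList n fun _ => true) * shiftPow h x k =
      listProd e (pointList n fun _ => true) := by
  have key : ∀ (z a : M) (j : ℕ), z * a = z → z * a ^ j = z := by
    intro z a j hz
    induction j with
    | zero => simp
    | succ j ih => rw [pow_succ, ← mul_assoc, ih, hz]
  rw [shiftPow]
  split_ifs
  · exact key _ _ _ F.all_mul_x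
  · exact key _ _ _ F.all_mul_y

/-- A map of rank one is a restriction of a translation and of a reflection. -/
theorem lone_shiftPow_eq (F : FullFrame n h x e) {p k k' : ℤ} (hp : 1 ≤ p ∧ p ≤ n)
    (hk : 1 ≤ p - k ∧ p - k ≤ n) (hkk : k + k' = 2 * p - n - 1) :
    listProd e (pointList n (· ≠ p)) * shiftPow h x k =
      listProd e (pointList n (· ≠ p)) * shiftPow h x k' * h := by
  -- The case of image `n`: the idempotent that keeps only `n` can be appended, and `x_pow_pred`
  -- replaces it by `x ^ (n - 1) * h`.
  have hr : listProd e (pointList n (· ≠ p)) * shiftPow h x (p - n) =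
      listProd e (pointList n (· ≠ p)) * shiftPow h x (p - 1) * h := by
    have h0 : listProd e (pointList n (· ≠ p)) * shiftPow h x (p - n) =
        listProd e (pointList n (· ≠ p)) * shiftPow h x (p - n) *
          listProd e (pointList n (· ≠ (n : ℤ))) := by
      rw [mul_assoc, F.shiftPow_listProd, ← mul_assoc, ← listProd_append]
      refine F.listProd_mul_shiftPow_congr fun a ha => ?_
      simp only [mem_pointList, List.mem_append, List.mem_map, decide_eq_true_eq]
      constructor
      · exact Or.inl
      · rintro (h1 | ⟨b, h1, rfl⟩)
        · exact h1
        · omega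
    rw [h0, ← F.x_pow_pred, ← mul_assoc, F.lone_shiftPow_mul_x_pow _ (by omega) (by omega)]
    congr 3
    omega
  -- Multiplying `hr` by `x ^ j` moves the image from `n` down to `p - k`; past `h` this becomes a
  -- power of the inverse shift.
  obtain ⟨j, hj⟩ : ∃ j : ℕ, k = p - n + j := ⟨(k - p + n).toNat, by omega⟩
  rw [hj, ← F.lone_shiftPow_mul_x_pow j (by omega) (by omega), hr, mul_assoc _ h,
    ← shiftPow_natCast (h := h), F.h_shiftPow, shiftPow_neg_natCast, ← mul_assoc,
    F.lone_shiftPow_mul_y_pow j (by omega) (by omega) hp.1]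
  congr 3
  omega

end FullFrame
end

/-! ### The presented monoid satisfies the calculus -/

/-- The presented monoid `⟨C | V⟩`. -/
abbrev Pres (n : ℕ) := PresentedMonoid (Relations n)

/-- The class of a word in the presented monoid. -/
abbrev cls (n : ℕ) : Word n →* Pres n := PresentedMonoid.mk (Relations n)

theorem cls_eq {n : ℕ} {u v : Word n} (h : Relations n u v) : cls n u = cls n v :=
  PresentedMonoid.mk_eq_mk_of_rel h

/-- The element of the presented monoid that stands for the partial identity missing `k`. -/
def idemElt (n : ℕ) (k : ℤ) : Pres n :=
  if k = 1 then cls n (XN n * H n * XN n * H n)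
  else if k = n then cls n (H n * XN n * H n * XN n)
  else if 2 ≤ k ∧ k ≤ n - 1 then
    if n - k ≤ ((n - 1) / 2 : ℕ) then cls n (X n (n - k).toNat)
    else cls n (H n * X n (k - 1).toNat * H n)
  else 1

section
variable {n : ℕ}

theorem cls_H_sq : cls n (H n) * cls n (H n) = 1 := by
  rw [← map_mul, ← pow_two, cls_eq Relations.invol, map_one]

theorem cls_H_H (a : Pres n) : cls n (H n) * (cls n (H n) * a) = a := by
  rw [← mul_assoc, cls_H_sq, one_mul]

theorem idemElt_one : idemElt n 1 = cls n (XN n * H n * XN n * H n) := if_pos rfl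

theorem idemElt_last (hn : 3 ≤ n) : idemElt n n = cls n (H n * XN n * H n * XN n) := by
  rw [idemElt, if_neg (by omega), if_pos rfl]

theorem idemElt_out (hn : 3 ≤ n) {k : ℤ} (hk : k < 1 ∨ n < k) : idemElt n k = 1 := by
  rw [idemElt, if_neg (by omega), if_neg (by omega), if_neg (by omega)]

theorem idemElt_right {i : ℕ} (h1 : 1 ≤ i) (h2 : i ≤ (n - 1) / 2) :
    idemElt n (n - i) = cls n (X n i) := by
  rw [idemElt, if_neg (by omega), if_neg (by omega), if_pos (by omega), if_pos (by omega)]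
  congr 2
  omega

/-- For odd `n` the middle point is both `n - i` and `i + 1`, with `i = (n - 1) / 2`; the relation
`central` makes its two names agree. -/
theorem idemElt_left {i : ℕ} (h1 : 1 ≤ i) (h2 : i ≤ (n - 1) / 2) :
    idemElt n (i + 1) = cls n (H n * X n i * H n) := by
  rw [idemElt, if_neg (by omega), if_neg (by omega), if_pos (by omega)]
  split_ifs with h
  · have hi : i = (n - 1) / 2 := by omega
    have hodd : Odd n := ⟨i, by omega⟩
    rw [show ((n : ℤ) - (i + 1)).toNat = (n - 1) / 2 by omega, hi, map_mul,
      cls_eq (Relations.central hodd), map_mul, mul_assoc, cls_H_sq, mul_one]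
  · congr 4
    omega

theorem interior_cases {k : ℤ} (h : 2 ≤ k ∧ k ≤ n - 1) :
    ∃ i : ℕ, (1 ≤ i ∧ i ≤ (n - 1) / 2) ∧ (k = n - i ∨ k = i + 1) := by
  by_cases hk : n - k ≤ ((n - 1) / 2 : ℕ)
  · exact ⟨(n - k).toNat, by omega, Or.inl (by omega)⟩
  · exact ⟨(k - 1).toNat, by omega, Or.inr (by omega)⟩

theorem H_mul_idemElt (hn : 3 ≤ n) (k : ℤ) :
    cls n (H n) * idemElt n k = idemElt n (n + 1 - k) * cls n (H n) := by
  by_cases h1 : k = 1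
  · rw [h1, idemElt_one, show (n : ℤ) + 1 - 1 = n by ring, idemElt_last hn]
    simp only [map_mul, mul_assoc]
  by_cases h2 : k = n
  · rw [h2, show (n : ℤ) + 1 - n = 1 by ring, idemElt_one, idemElt_last hn]
    simp only [map_mul, mul_assoc, cls_H_sq, cls_H_H, mul_one]
  by_cases h3 : k < 1 ∨ n < k
  · rw [idemElt_out hn h3, idemElt_out hn (by omega), one_mul, mul_one]
  obtain ⟨i, hi, rfl | rfl⟩ := interior_cases (n := n) (k := k) (by omega)
  · rw [show (n : ℤ) + 1 - (n - i) = i + 1 by ring, idemElt_right hi.1 hi.2,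
      idemElt_left hi.1 hi.2]
    simp only [map_mul, mul_assoc, cls_H_sq, mul_one]
  · rw [show (n : ℤ) + 1 - (i + 1) = n - i by ring, idemElt_right hi.1 hi.2,
      idemElt_left hi.1 hi.2]
    simp only [map_mul, mul_assoc, cls_H_H]

/-- The relations divide the values of `k`: `rel10` serves `0` and `n`, `rel7` serves `1`, `rel8`
serves `n - 1`, `shift` and `shiftConj` the two halves, and `shiftMid` the step from the left half
to the right. -/
theorem XN_mul_idemElt (hn : 3 ≤ n) (k : ℤ) :
    cls n (XN n) * idemElt n k = idemElt n (k + 1) * cls n (XN n) := by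
  have h10 := cls_eq (Relations.rel10 (n := n))
  by_cases h0 : k = 0
  · rw [h0, idemElt_out hn (by omega), zero_add, idemElt_one, ← map_mul, h10, mul_one]
  by_cases hl : k = n
  · rw [hl, idemElt_out hn (k := n + 1) (by omega), idemElt_last hn, one_mul, ← h10]
    simp only [map_mul, mul_assoc] at h10 ⊢
    simp only [h10]
  by_cases hout : k < 1 ∨ n < k
  · rw [idemElt_out hn hout, idemElt_out hn (by omega), one_mul, mul_one]
  by_cases h1 : k = 1
  · have h7 := cls_eq (Relations.rel7 (n := n))
    have h2 := idemElt_left (n := n) (i := 1) le_rfl (by omega)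
    rw [h1, idemElt_one, show (1 : ℤ) + 1 = (1 : ℕ) + 1 by rfl, h2, ← map_mul, ← map_mul, ← h7,
      pow_two]
    simp only [mul_assoc]
  by_cases h2 : k = n - 1
  · have h8 := cls_eq (Relations.rel8 (n := n))
    have h3 := idemElt_right (n := n) (i := 1) le_rfl (by omega)
    rw [Nat.cast_one] at h3
    rw [h2, sub_add_cancel, h3, idemElt_last hn, ← map_mul, ← map_mul, ← h8, pow_two]
    simp only [mul_assoc]
  by_cases h3 : n - k ≤ ((n - 1) / 2 : ℕ)
  · obtain ⟨i, rfl⟩ : ∃ i : ℕ, k = n - (i + 1 : ℕ) := ⟨(n - k - 1).toNat, by omega⟩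
    have h4 := cls_eq (Relations.shift (n := n) i (by omega) (by omega))
    rw [idemElt_right (by omega) (by omega),
      show (n : ℤ) - (i + 1 : ℕ) + 1 = n - i by push_cast; ring,
      idemElt_right (by omega) (by omega), ← map_mul, h4, map_mul]
  obtain ⟨i, rfl⟩ : ∃ i : ℕ, k = i + 1 := ⟨(k - 1).toNat, by omega⟩
  rw [idemElt_left (by omega) (by omega)]
  by_cases h5 : i = (n - 2) / 2
  · have h4 := cls_eq (Relations.shiftMid (n := n) (by omega))
    rw [show (i : ℤ) + 1 + 1 = n - ((n - 1) / 2 : ℕ) by omega,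
      idemElt_right (by omega) (by omega), ← map_mul, ← map_mul, ← h4, h5]
    simp only [mul_assoc]
  · have h4 := cls_eq (Relations.shiftConj (n := n) i (by omega) (by omega))
    rw [← Nat.cast_succ, idemElt_left (by omega) (by omega), ← map_mul, ← map_mul, ← h4]
    simp only [mul_assoc]

theorem idemElt_conj (hn : 3 ≤ n) (k : ℤ) :
    idemElt n k = cls n (H n) * idemElt n (n + 1 - k) * cls n (H n) := by
  rw [H_mul_idemElt hn, mul_assoc, cls_H_sq, mul_one, sub_sub_cancel]

theorem idemElt_sq (hn : 3 ≤ n) (k : ℤ) : idemElt n k * idemElt n k = idemElt n k := by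
  have conj : ∀ j, idemElt n j * idemElt n j = idemElt n j →
      idemElt n (n + 1 - j) * idemElt n (n + 1 - j) = idemElt n (n + 1 - j) := by
    intro j hj
    rw [idemElt_conj hn (n + 1 - j), sub_sub_cancel]
    conv_rhs => rw [← hj]
    simp only [mul_assoc, cls_H_H]
  have h1 : idemElt n 1 * idemElt n 1 = idemElt n 1 := by
    have h10 := cls_eq (Relations.rel10 (n := n))
    rw [idemElt_one, ← map_mul, ← mul_assoc (_ * _ * _), ← mul_assoc (_ * _), ← mul_assoc (_ * _),
      map_mul _ _ (H n), map_mul _ _ (XN n), map_mul _ _ (H n), h10]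
    simp only [map_mul]
  by_cases hk : k = 1
  · rw [hk, h1]
  by_cases hl : k = n
  · have := conj 1 h1
    rwa [show (n : ℤ) + 1 - 1 = n by ring, ← hl] at this
  by_cases hout : k < 1 ∨ n < k
  · rw [idemElt_out hn hout, one_mul]
  obtain ⟨i, hi, h⟩ := interior_cases (n := n) (k := k) (by omega)
  have hX : idemElt n (n - i) * idemElt n (n - i) = idemElt n (n - i) := by
    rw [idemElt_right hi.1 hi.2, ← map_mul, ← pow_two, cls_eq (Relations.idem i hi.1 hi.2)]
  rcases h with rfl | rfl
  · exact hX
  · have := conj _ hX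
    rwa [show (n : ℤ) + 1 - (n - i) = i + 1 by ring] at this

theorem idemElt_comm (hn : 3 ≤ n) (j k : ℤ) :
    idemElt n j * idemElt n k = idemElt n k * idemElt n j := by
  have conj : ∀ j k, idemElt n j * idemElt n k = idemElt n k * idemElt n j →
      idemElt n (n + 1 - j) * idemElt n (n + 1 - k) =
        idemElt n (n + 1 - k) * idemElt n (n + 1 - j) := by
    intro j k hjk
    rw [idemElt_conj hn (n + 1 - j), idemElt_conj hn (n + 1 - k), sub_sub_cancel, sub_sub_cancel]
    have := congrArg (fun z => cls n (H n) * (z * cls n (H n))) hjk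
    simpa only [mul_assoc, cls_H_H] using this
  -- `idemElt n 1` is the shift times its inverse; passing an idempotent through both lowers its
  -- index by one and raises it again.
  have one : ∀ k, idemElt n 1 * idemElt n k = idemElt n k * idemElt n 1 := by
    intro k
    have h2 := XN_mul_idemElt hn (n + 1 - k)
    have h3 := XN_mul_idemElt hn (k - 1)
    have h4 : cls n (H n) * cls n (XN n) * cls n (H n) * idemElt n k =
        idemElt n (k - 1) * (cls n (H n) * cls n (XN n) * cls n (H n)) := by
      rw [mul_assoc, H_mul_idemElt hn, mul_assoc, ← mul_assoc (cls n (XN n)), h2, ← mul_assoc,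
        ← mul_assoc, H_mul_idemElt hn, show (n : ℤ) + 1 - (n + 1 - k + 1) = k - 1 by ring]
      simp only [mul_assoc]
    rw [sub_add_cancel] at h3
    rw [idemElt_one, mul_assoc, mul_assoc, map_mul, map_mul, map_mul, mul_assoc,
      ← mul_assoc (cls n (H n)), h4, ← mul_assoc, h3]
    simp only [mul_assoc]
  have last : ∀ k, idemElt n n * idemElt n k = idemElt n k * idemElt n n := by
    intro k
    have := conj 1 (n + 1 - k) (one _)
    rwa [show (n : ℤ) + 1 - 1 = n by ring, sub_sub_cancel] at this
  by_cases hj1 : j = 1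
  · rw [hj1, one]
  by_cases hk1 : k = 1
  · rw [hk1, one]
  by_cases hjn : j = n
  · rw [hjn, last]
  by_cases hkn : k = n
  · rw [hkn, last]
  by_cases hj : j < 1 ∨ n < j
  · rw [idemElt_out hn hj, one_mul, mul_one]
  by_cases hk : k < 1 ∨ n < k
  · rw [idemElt_out hn hk, one_mul, mul_one]
  have right : ∀ i i' : ℕ, 1 ≤ i → i < i' → i' ≤ (n - 1) / 2 →
      idemElt n (n - i) * idemElt n (n - i') = idemElt n (n - i') * idemElt n (n - i) := by
    intro i i' h1 h2 h3
    rw [idemElt_right h1 (by omega), idemElt_right (by omega) h3, ← map_mul, ← map_mul,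
      cls_eq (Relations.comm i i' h1 h2 h3)]
  have mixed : ∀ i i' : ℕ, 1 ≤ i → i ≤ (n - 1) / 2 → 1 ≤ i' → i' ≤ (n - 1) / 2 →
      i' + 1 + (n - 1) / 2 < n →
      idemElt n (n - i) * idemElt n (i' + 1) = idemElt n (i' + 1) * idemElt n (n - i) := by
    intro i i' h1 h2 h3 h4 h5
    have := cls_eq (Relations.commConj (n := n) i (n - i' - 1) h1 h2 (by omega) (by omega))
    rw [show n - (n - i' - 1) - 1 = i' by omega] at this
    rw [idemElt_right h1 h2, idemElt_left h3 h4, ← map_mul, ← map_mul, ← this]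
    simp only [mul_assoc]
  have main : ∀ j k : ℤ, 2 ≤ k → k < j → j ≤ n - 1 →
      idemElt n j * idemElt n k = idemElt n k * idemElt n j := by
    intro j k h1 h2 h3
    by_cases hk : n - k ≤ ((n - 1) / 2 : ℕ)
    · have := right (n - j).toNat (n - k).toNat (by omega) (by omega) (by omega)
      rwa [show (n : ℤ) - (n - j).toNat = j by omega,
        show (n : ℤ) - (n - k).toNat = k by omega] at this
    by_cases hj : n - j ≤ ((n - 1) / 2 : ℕ)
    · have := mixed (n - j).toNat (k - 1).toNat (by omega) (by omega) (by omega) (by omega)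
        (by omega)
      rwa [show (n : ℤ) - (n - j).toNat = j by omega,
        show ((k - 1).toNat : ℤ) + 1 = k by omega] at this
    · have := conj _ _ (right (k - 1).toNat (j - 1).toNat (by omega) (by omega) (by omega))
      rw [show (n : ℤ) + 1 - (n - (k - 1).toNat) = k by omega,
        show (n : ℤ) + 1 - (n - (j - 1).toNat) = j by omega] at this
      exact this.symm
  rcases lt_trichotomy j k with h | rfl | h
  · exact (main k j (by omega) h (by omega)).symm
  · rfl
  · exact main j k (by omega) h (by omega)

theorem frame (hn : 3 ≤ n) : Frame n (cls n (H n)) (cls n (XN n)) (idemElt n) where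
  h_sq := cls_H_sq
  h_e := H_mul_idemElt hn
  x_e := XN_mul_idemElt hn
  e_one := by
    rw [idemElt_one]
    simp only [map_mul, mul_assoc]
  e_out _ hk := idemElt_out hn hk
  e_sq := idemElt_sq hn
  e_comm := idemElt_comm hn

theorem cls_list (l : List ℕ) (hl : ∀ t ∈ l, t + 1 ≤ (n - 1) / 2) :
    cls n (l.map fun t => X n (t + 1)).prod =
      listProd (idemElt n) (l.map fun t : ℕ => (n : ℤ) - (t + 1 : ℕ)) := by
  induction l with
  | nil => rfl
  | cons t l ih =>
    rw [List.map_cons, List.prod_cons, map_mul, ih fun s hs => hl s (List.mem_cons_of_mem _ hs),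
      List.map_cons, listProd_cons, idemElt_right (by omega) (hl t (by simp))]

theorem cls_ascWord (hn : 3 ≤ n) {k : ℕ} (hk : k ≤ (n - 1) / 2) :
    cls n (ascWord n k) =
      listProd (idemElt n) (pointList n fun a => n - k ≤ a ∧ a ≤ n - 1) := by
  rw [ascWord, cls_list _ fun t ht => by rw [List.mem_range] at ht; omega]
  refine (frame hn).listProd_congr fun a h1 h2 => ?_
  simp only [List.mem_map, List.mem_range, mem_pointList, decide_eq_true_eq]
  constructor
  · rintro ⟨t, ht, rfl⟩
    omega
  · intro h
    exact ⟨(n - 1 - a).toNat, by omega, by omega⟩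

theorem cls_descWord (hn : 3 ≤ n) {k : ℕ} (hk : k ≤ (n - 1) / 2) :
    cls n (descWord n k) =
      listProd (idemElt n) (pointList n fun a => n - k ≤ a ∧ a ≤ n - 1) := by
  rw [descWord, cls_list _ fun t ht => by rw [List.mem_reverse, List.mem_range] at ht; omega]
  refine (frame hn).listProd_congr fun a h1 h2 => ?_
  simp only [List.mem_map, List.mem_reverse, List.mem_range, mem_pointList, decide_eq_true_eq]
  constructor
  · rintro ⟨t, ht, rfl⟩
    omega
  · intro h
    exact ⟨(n - 1 - a).toNat, by omega, by omega⟩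

theorem fullFrame (hn : 3 ≤ n) : FullFrame n (cls n (H n)) (cls n (XN n)) (idemElt n) where
  toFrame := frame hn
  x_pow := by
    have F := frame hn
    have h1 := idemElt_right (n := n) (i := 1) le_rfl (by omega)
    have h2 := F.x_e (n - 1)
    have h3 := F.h_e n
    rw [sub_add_cancel] at h2
    rw [show (n : ℤ) + 1 - n = 1 by ring] at h3
    have e1 : listProd (idemElt n) [1] = idemElt n 1 := by simp [listProd]
    rw [Nat.cast_one] at h1
    rw [← map_pow, cls_eq Relations.rel11]
    simp only [map_mul]
    rw [cls_ascWord hn le_rfl, cls_descWord hn (by omega), ← h1, mul_assoc _ (cls n (H n)),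
      F.h_listProd, mul_assoc _ (cls n (XN n)), h2]
    have h4 : ∀ a, cls n (H n) * (idemElt n n * a) = listProd (idemElt n) [1] * (cls n (H n) * a) :=
      fun a => by rw [← mul_assoc, h3, e1, mul_assoc]
    simp only [mul_assoc, h4]
    have hy : cls n (H n) * (cls n (XN n) * cls n (H n)) =
        shiftPow (cls n (H n)) (cls n (XN n)) (-1) := by
      have := shiftPow_neg_natCast (h := cls n (H n)) (x := cls n (XN n)) 1
      rw [pow_one, mul_assoc] at this
      exact this.symm
    rw [hy, ← mul_assoc, ← mul_assoc, ← listProd_append, ← listProd_append]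
    -- The idempotents present miss `1, …, n - 1`; the point `n` comes for free, since the inverse
    -- shift is undefined there.
    refine F.listProd_mul_shiftPow_congr fun a ha => ?_
    simp only [List.mem_append, List.mem_map, mem_pointList, decide_eq_true_eq, List.mem_singleton,
      and_true]
    refine ⟨fun _ => ha.1, fun _ => ?_⟩
    by_cases ha : 2 ≤ a ∧ a < n - ((n - 1) / 2 : ℕ)
    · exact Or.inl (Or.inr ⟨n + 1 - a, by omega, by omega⟩)
    by_cases ha1 : a = 1
    · exact Or.inr ha1
    · exact Or.inl (Or.inl (by omega))
  x_pow_succ := by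
    rw [← map_pow, ← map_pow, cls_eq Relations.rel12]
  x_pow_pred := by
    have F := frame hn
    rw [← map_pow, ← map_mul, cls_eq Relations.rank1]
    simp only [map_mul]
    have e1 : listProd (idemElt n) [1] =
        cls n (XN n) * cls n (H n) * cls n (XN n) * cls n (H n) := by
      simp [listProd, idemElt_one]
    rw [cls_ascWord hn (by omega), cls_descWord hn le_rfl, mul_assoc _ _ (cls n (H n)),
      F.listProd_h, ← mul_assoc, ← e1, ← listProd_append, ← listProd_append]
    refine F.listProd_congr fun a h1 h2 => ?_
    simp only [List.mem_append, List.mem_map, mem_pointList, decide_eq_true_eq, List.mem_singleton]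
    constructor
    · rintro ((rfl | ⟨b, hb, rfl⟩) | h) <;> omega
    · intro h
      by_cases ha : 2 ≤ a ∧ a < n - ((n - 1) / 2 : ℕ)
      · exact Or.inl (Or.inr ⟨n + 1 - a, by omega, by omega⟩)
      · omega

end

/-! ### Normal forms -/

/-- The normal form `e_l * x ^ k` or `e_l * x ^ k * h`. -/
def normalForm {M : Type*} [Monoid M] (h x : M) (e : ℤ → M) (l : List ℤ) (k : ℤ) (b : Bool) : M :=
  listProd e l * shiftPow h x k * (if b then h else 1)

section
variable {M : Type*} [Monoid M] {n : ℕ} {h x : M} {e : ℤ → M}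

theorem listProd_mul_e (l : List ℤ) (j : ℤ) : listProd e l * e j = listProd e (l ++ [j]) := by
  simp [listProd]

theorem Frame.normalForm_mul_h (F : Frame n h x e) (l : List ℤ) (k : ℤ) (b : Bool) :
    normalForm h x e l k b * h = normalForm h x e l k (!b) := by
  cases b <;> simp [normalForm, mul_assoc, F.h_sq]

theorem Frame.normalForm_mul_e (F : Frame n h x e) (l : List ℤ) (k : ℤ) (b : Bool) (j : ℤ) :
    ∃ l', normalForm h x e l k b * e j = normalForm h x e l' k b := by
  cases b
  · refine ⟨l ++ [j + k], ?_⟩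
    simp [normalForm, mul_assoc, F.shiftPow_e, ← listProd_mul_e]
  · refine ⟨l ++ [n + 1 - j + k], ?_⟩
    simp only [normalForm, if_true, mul_assoc, F.h_e, ← listProd_mul_e]
    rw [← mul_assoc (shiftPow h x k), F.shiftPow_e, mul_assoc]

theorem Frame.normalForm_mul_x (F : Frame n h x e) (l : List ℤ) (k : ℤ) (b : Bool) :
    ∃ l' k', normalForm h x e l k b * x = normalForm h x e l' k' b := by
  cases b
  · refine ⟨l ++ [if k < 0 then n + k + 1 else 0], k + 1, ?_⟩
    rw [normalForm, normalForm, ← listProd_mul_e]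
    simp only [Bool.false_eq_true, if_false, mul_one]
    rw [mul_assoc, F.shiftPow_mul_x, mul_assoc]
  · refine ⟨l ++ [if 0 < k then k else 0], k - 1, ?_⟩
    rw [normalForm, normalForm, ← listProd_mul_e, if_pos rfl, mul_assoc (listProd e l) (e _),
      ← F.shiftPow_mul_y]
    simp only [mul_assoc, F.h_sq, mul_one]

theorem FullFrame.normalForm_eq_all (F : FullFrame n h x e) (hn : 1 ≤ n) {l : List ℤ} {k : ℤ}
    {b : Bool} (hl : ∀ a : ℤ, (1 ≤ a ∧ a ≤ n) ∧ 1 ≤ a - k ∧ a - k ≤ n → a ∈ l) :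
    normalForm h x e l k b = listProd e (pointList n fun _ => true) := by
  rw [normalForm, F.listProd_mul_shiftPow_congr (l' := pointList n fun _ => true),
    F.all_mul_shiftPow]
  · split_ifs
    · exact F.all_mul_h hn
    · exact mul_one _
  · intro a ha
    simp [mem_pointList, ha.1, hl a ha]

theorem FullFrame.normalForm_eq_lone (F : FullFrame n h x e) {p : ℤ} {l : List ℤ} {k : ℤ}
    {b : Bool} (hl : ∀ a : ℤ, (1 ≤ a ∧ a ≤ n) ∧ 1 ≤ a - k ∧ a - k ≤ n → (a ∉ l ↔ a = p)) :
    normalForm h x e l k b = normalForm h x e (pointList n (· ≠ p)) k b := by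
  rw [normalForm, F.listProd_mul_shiftPow_congr, normalForm]
  intro a ha
  have := hl a ha
  simp only [mem_pointList, decide_eq_true_eq]
  tauto

/-- The point to which a normal form with exponents `k`, `b` moves `a`. -/
def image (n : ℕ) (k : ℤ) (b : Bool) (a : ℤ) : ℤ := if b then n + 1 - (a - k) else a - k

/-- The domain of a normal form. -/
def Dom (n : ℕ) (l : List ℤ) (k a : ℤ) : Prop := ((1 ≤ a ∧ a ≤ n) ∧ 1 ≤ a - k ∧ a - k ≤ n) ∧ a ∉ l

/-- By rank: two points of the domain determine `k` and `b`, a single point leaves the ambiguity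
settled by `lone_shiftPow_eq`, and an empty domain gives the full product. -/
theorem FullFrame.normalForm_congr (F : FullFrame n h x e) (hn : 1 ≤ n) {l l' : List ℤ} {k k' : ℤ}
    {b b' : Bool} (hD : ∀ a, Dom n l k a ↔ Dom n l' k' a)
    (hi : ∀ a, Dom n l k a → image n k b a = image n k' b' a) :
    normalForm h x e l k b = normalForm h x e l' k' b' := by
  by_cases h0 : ∃ p, Dom n l k p
  · obtain ⟨p, hp⟩ := h0
    by_cases h1 : ∃ q, Dom n l k q ∧ q ≠ p
    · obtain ⟨q, hq, hqp⟩ := h1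
      have hp' := hi p hp
      have hq' := hi q hq
      obtain ⟨rfl, rfl⟩ : k = k' ∧ b = b' := by
        cases b <;> cases b' <;> simp [image] at * <;> omega
      rw [normalForm, F.listProd_mul_shiftPow_congr, normalForm]
      intro a ha
      have := hD a
      unfold Dom at this
      tauto
    · push Not at h1
      have hp' := (hD p).1 hp
      rw [F.normalForm_eq_lone (p := p) (l := l), F.normalForm_eq_lone (p := p) (l := l')]
      · have hip := hi p hp
        have hb := hp.1
        have hb' := hp'.1
        cases b <;> cases b' <;> simp only [image, Bool.false_eq_true, if_false, if_true] at hip <;>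
          simp only [normalForm, Bool.false_eq_true, if_false, if_true, mul_one]
        · rw [show k = k' by omega]
        · exact F.lone_shiftPow_eq hb.1 hb.2 (by omega)
        · exact (F.lone_shiftPow_eq hb.1 hb'.2 (by omega)).symm
        · rw [show k = k' by omega]
      · intro a ha
        exact ⟨fun h => h1 a ((hD a).2 ⟨ha, h⟩), fun h => h ▸ hp'.2⟩
      · intro a ha
        exact ⟨fun h => h1 a ⟨ha, h⟩, fun h => h ▸ hp.2⟩
  · rw [F.normalForm_eq_all hn, F.normalForm_eq_all hn]
    · intro a ha
      by_contra h
      exact h0 ⟨a, (hD a).2 ⟨ha, h⟩⟩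
    · intro a ha
      by_contra h
      exact h0 ⟨a, ha, h⟩

end

/-! ### The isomorphism onto `DP n` -/

section
variable {n : ℕ}

/-- The homomorphism from the presented monoid to `DP_n`. -/
def toDP (hn : 3 ≤ n) : Pres n →* DP n :=
  PresentedMonoid.lift (gen n) fun _ _ h => Subtype.ext (val_eq_of_relations hn h)

theorem toDP_cls (hn : 3 ≤ n) (w : Word n) : (toDP hn (cls n w) : PartialPerm n) = val n w := rfl

theorem acts_idemElt (hn : 3 ≤ n) (k : ℤ) :
    Acts (toDP hn (idemElt n k) : PartialPerm n) (fun a => 1 ≤ a ∧ a ≤ n ∧ a ≠ k)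
      (fun a => a) := by
  by_cases h1 : k = 1
  · rw [h1, idemElt_one, toDP_cls]
    simp only [map_mul]
    exact (((acts_XN.mul acts_H).mul acts_XN).mul acts_H).congr (fun a => by omega)
      (fun a _ => by omega)
  by_cases h2 : k = n
  · rw [h2, idemElt_last hn, toDP_cls]
    simp only [map_mul]
    exact (((acts_H.mul acts_XN).mul acts_H).mul acts_XN).congr (fun a => by omega)
      (fun a _ => by omega)
  by_cases h3 : k < 1 ∨ n < k
  · rw [idemElt_out hn h3, map_one]
    exact acts_one.congr (fun a => by omega) (fun a _ => rfl)
  obtain ⟨i, hi, rfl | rfl⟩ := interior_cases (n := n) (k := k) (by omega)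
  · rw [idemElt_right hi.1 hi.2, toDP_cls]
    exact acts_X hi.1 hi.2
  · rw [idemElt_left hi.1 hi.2, toDP_cls]
    simp only [map_mul]
    exact ((acts_H.mul (acts_X hi.1 hi.2)).mul acts_H).congr (fun a => by omega)
      (fun a _ => by omega)

theorem acts_listProd (hn : 3 ≤ n) (l : List ℤ) :
    Acts (toDP hn (listProd (idemElt n) l) : PartialPerm n) (fun a => (1 ≤ a ∧ a ≤ n) ∧ a ∉ l)
      (fun a => a) := by
  induction l with
  | nil => simpa [listProd_nil] using acts_one
  | cons k l ih =>
    rw [listProd_cons, map_mul, Submonoid.coe_mul]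
    refine ((acts_idemElt hn k).mul ih).congr (fun a => ?_) (fun a _ => rfl)
    rw [List.mem_cons]
    tauto

theorem acts_shiftPow (hn : 3 ≤ n) (k : ℤ) :
    Acts (toDP hn (shiftPow (cls n (H n)) (cls n (XN n)) k) : PartialPerm n)
      (fun a => (1 ≤ a ∧ a ≤ n) ∧ 1 ≤ a - k ∧ a - k ≤ n) (fun a => a - k) := by
  obtain ⟨k, rfl | rfl⟩ := k.eq_nat_or_neg
  · rw [shiftPow_natCast, ← map_pow, toDP_cls]
    exact (acts_XN_pow k).congr (fun a => by omega) (fun a _ => rfl)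
  · rw [shiftPow_neg_natCast, ← map_mul, ← map_mul, ← map_pow, toDP_cls]
    induction k with
    | zero =>
      rw [pow_zero, map_one]
      exact acts_one.congr (fun a => by simp) (fun a _ => by simp)
    | succ k ih =>
      rw [pow_succ]
      simp only [map_mul] at ih ⊢
      exact (ih.mul ((acts_H.mul acts_XN).mul acts_H)).congr (fun a => by push_cast; omega)
        (fun a _ => by push_cast; omega)

/-- The normal form in the presented monoid. -/
abbrev presForm (n : ℕ) (l : List ℤ) (k : ℤ) (b : Bool) : Pres n :=
  normalForm (cls n (H n)) (cls n (XN n)) (idemElt n) l k b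

theorem acts_presForm (hn : 3 ≤ n) (l : List ℤ) (k : ℤ) (b : Bool) :
    Acts (toDP hn (presForm n l k b) : PartialPerm n) (Dom n l k) (image n k b) := by
  have h1 := (acts_listProd hn l).mul (acts_shiftPow hn k)
  rw [presForm, normalForm, map_mul, map_mul, Submonoid.coe_mul, Submonoid.coe_mul]
  cases b
  · simp only [Bool.false_eq_true, if_false, map_one, Submonoid.coe_one, mul_one]
    exact h1.congr (fun a => by unfold Dom; tauto) (fun a _ => rfl)
  · simp only [if_true]
    exact (h1.mul acts_H).congr (fun a => by unfold Dom; tauto) (fun a _ => rfl)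

theorem exists_presForm (hn : 3 ≤ n) (p : Pres n) : ∃ l k b, p = presForm n l k b := by
  have hp : p ∈ Submonoid.closure (Set.range (PresentedMonoid.of (Relations n))) := by
    rw [PresentedMonoid.closure_range_of]
    trivial
  induction hp using Submonoid.closure_induction_right with
  | one => exact ⟨[], 0, false, by simp [normalForm, listProd, shiftPow]⟩
  | mul_right p _ c hc ih =>
    obtain ⟨l, k, b, rfl⟩ := ih
    obtain ⟨c, rfl⟩ := hc
    cases c with
    | h => exact ⟨l, k, !b, (frame hn).normalForm_mul_h l k b⟩
    | xn =>
      obtain ⟨l', k', h⟩ := (frame hn).normalForm_mul_x l k b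
      exact ⟨l', k', b, h⟩
    | x i =>
      obtain ⟨l', h⟩ := (frame hn).normalForm_mul_e l k b (n - (i + 1 : ℕ))
      rw [idemElt_right (by omega) (by omega), X, dif_pos ⟨by omega, by omega⟩] at h
      exact ⟨l', k, b, h⟩

theorem toDP_injective (hn : 3 ≤ n) : Function.Injective (toDP hn) := by
  intro p q hpq
  obtain ⟨l, k, b, rfl⟩ := exists_presForm hn p
  obtain ⟨l', k', b', rfl⟩ := exists_presForm hn q
  have h1 := acts_presForm hn l k b
  have h2 := acts_presForm hn l' k' b'
  rw [hpq] at h1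
  have key : ∀ a, Dom n l k a → Dom n l' k' a ∧ image n k b a = image n k' b' a := fun a ha =>
    (h2 _ _).1 ((h1 _ _).2 ⟨ha, rfl⟩)
  refine (fullFrame hn).normalForm_congr (by omega)
    (fun a => ⟨fun ha => (key a ha).1, fun ha => ?_⟩)
    fun a ha => (key a ha).2
  exact ((h1 _ _).1 ((h2 _ _).2 ⟨ha, rfl⟩)).1

theorem graph_isometry {α : PartialPerm n} (hα : α ∈ DP n) {a a' b b' : ℤ} (h : Graph α a b)
    (h' : Graph α a' b') : |b - b'| = |a - a'| := by
  obtain ⟨i, j, rfl, rfl, hij⟩ := h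
  obtain ⟨i', j', rfl, rfl, hij'⟩ := h'
  have := hα i i' j j' hij hij'
  rwa [add_sub_add_right_eq_sub, add_sub_add_right_eq_sub]

/-- A partial isometry is a restriction of a translation or of a reflection. -/
theorem exists_image {α : PartialPerm n} (hα : α ∈ DP n) :
    ∃ k b, ∀ a c, Graph α a c → c = image n k b a := by
  by_cases h0 : ∃ p q, Graph α p q
  · obtain ⟨p, q, hpq⟩ := h0
    by_cases h1 : ∃ p' q', Graph α p' q' ∧ p' ≠ p
    · obtain ⟨p', q', hpq', hne⟩ := h1
      have h2 := graph_isometry hα hpq hpq'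
      by_cases h3 : q - q' = p - p'
      · refine ⟨p - q, false, fun a c hac => ?_⟩
        have h4 := graph_isometry hα hac hpq
        have h5 := graph_isometry hα hac hpq'
        simp only [image, Bool.false_eq_true, if_false]
        rw [abs_eq_abs] at h4 h5
        omega
      -- The reflection `a ↦ p + q - a`; distances to two distinct points determine the image of
      -- every other point.
      · refine ⟨p + q - n - 1, true, fun a c hac => ?_⟩
        have h4 := graph_isometry hα hac hpq
        have h5 := graph_isometry hα hac hpq'
        simp only [image, if_true]
        rw [abs_eq_abs] at h2 h4 h5
        omega
    · push Not at h1
      refine ⟨p - q, false, fun a c hac => ?_⟩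
      obtain rfl := h1 a c hac
      rw [hac.unique hpq]
      simp [image]
  · exact ⟨0, false, fun a c hac => (h0 ⟨a, c, hac⟩).elim⟩

theorem toDP_surjective (hn : 3 ≤ n) : Function.Surjective (toDP hn) := by
  classical
  rintro ⟨α, hα⟩
  obtain ⟨k, b, hk⟩ := exists_image hα
  refine ⟨presForm n (pointList n fun a => ¬ ∃ c, Graph α a c) k b, Subtype.ext ?_⟩
  refine graph_ext fun a c => ?_
  rw [acts_presForm hn _ k b a c, Dom, mem_pointList, decide_eq_true_eq]
  constructor
  · rintro ⟨⟨h1, h2⟩, rfl⟩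
    have h3 : ∃ c, Graph α a c := by
      by_contra h
      exact h2 ⟨h1.1, h⟩
    obtain ⟨c, hc⟩ := h3
    rwa [← hk a c hc]
  · intro hac
    have hb := hac.bounds
    have hc := hk a c hac
    refine ⟨⟨⟨hb.1, ?_⟩, fun h => h.2 ⟨c, hac⟩⟩, hc⟩
    cases b <;> simp only [image, Bool.false_eq_true, if_false, if_true] at hc <;> omega

/-- The isomorphism from the presented monoid onto `DP_n`. -/
noncomputable def equivDP (hn : 3 ≤ n) : Pres n ≃* DP n :=
  MulEquiv.ofBijective (toDP hn) ⟨toDP_injective hn, toDP_surjective hn⟩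

theorem equivDP_of (hn : 3 ≤ n) (c : Letter n) :
    equivDP hn (PresentedMonoid.of (Relations n) c) = gen n c := rfl

theorem closure_range_gen (hn : 3 ≤ n) : Submonoid.closure (Set.range (gen n)) = ⊤ := by
  have h1 : Set.range (gen n) = toDP hn '' Set.range (PresentedMonoid.of (Relations n)) := by
    rw [← Set.range_comp]
    rfl
  rw [h1, ← MonoidHom.map_mclosure, PresentedMonoid.closure_range_of, ← MonoidHom.mrange_eq_map,
    MonoidHom.mrange_eq_top]
  exact toDP_surjective hn

end

/-! ### Minimal size of a generating set -/

section
variable {n : ℕ}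

theorem gen_injective (hn : 3 ≤ n) : Function.Injective (gen n) := by
  have idem : ∀ i : Fin ((n - 1) / 2), ∀ a b, Graph (gen n (.x i) : PartialPerm n) a b ↔
      (1 ≤ a ∧ a ≤ n ∧ a ≠ n - (i + 1 : ℕ)) ∧ b = a := fun i =>
    graph_idemMap (i + 1) (by omega)
  have ht : ∀ a b, Graph (gen n .h : PartialPerm n) a b ↔ (1 ≤ a ∧ a ≤ n) ∧ b = n + 1 - a :=
    graph_hMap
  have xt : ∀ a b, Graph (gen n .xn : PartialPerm n) a b ↔ (2 ≤ a ∧ a ≤ n) ∧ b = a - 1 :=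
    graph_shiftMap
  have hx : gen n .h ≠ gen n .xn := by
    intro h
    have := ht 1 n
    rw [h, xt] at this
    omega
  have hi : ∀ i, gen n .h ≠ gen n (.x i) := by
    intro i h
    have := ht 1 n
    rw [h, idem] at this
    omega
  have xi : ∀ i, gen n .xn ≠ gen n (.x i) := by
    intro i h
    have := xt n (n - 1)
    rw [h, idem] at this
    omega
  intro c d h
  cases c with
  | h =>
    cases d with
    | h => rfl
    | xn => exact absurd h hx
    | x i => exact absurd h (hi i)
  | xn =>
    cases d with
    | h => exact absurd h.symm hx
    | xn => rfl
    | x i => exact absurd h (xi i)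
  | x i =>
    cases d with
    | h => exact absurd h.symm (hi i)
    | xn => exact absurd h.symm (xi i)
    | x j =>
      have h1 := idem i (n - (j + 1 : ℕ)) (n - (j + 1 : ℕ))
      rw [h, idem] at h1
      congr 1
      ext
      omega

/-- Letters as an iterated `Option`. -/
def letterEquiv (n : ℕ) : Letter n ≃ Option (Option (Fin ((n - 1) / 2))) where
  toFun
    | .h => none
    | .xn => some none
    | .x i => some (some i)
  invFun
    | none => .h
    | some none => .xn
    | some (some i) => .x i
  left_inv c := by cases c <;> rfl
  right_inv c := by rcases c with _ | _ | i <;> rfl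

theorem card_letter (hn : 3 ≤ n) : Nat.card (Letter n) = (n + 3) / 2 := by
  rw [Nat.card_congr (letterEquiv n), Nat.card_eq_fintype_card, Fintype.card_option,
    Fintype.card_option, Fintype.card_fin]
  omega

/-- `α` is defined at the point `a`. -/
def DefinedAt (α : PartialPerm n) (a : ℤ) : Prop := ∃ b, Graph α a b

theorem DefinedAt.bounds {α : PartialPerm n} {a : ℤ} (h : DefinedAt α a) : 1 ≤ a ∧ a ≤ n := by
  obtain ⟨b, hb⟩ := h
  exact hb.bounds.1

/-- A total partial isometry is the identity or the reflection. -/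
theorem total_cases {α : PartialPerm n} (hα : α ∈ DP n) (hn : 1 ≤ n)
    (h : ∀ a : ℤ, 1 ≤ a ∧ a ≤ n → DefinedAt α a) : α = 1 ∨ α = hMap n := by
  obtain ⟨k, b, hk⟩ := exists_image hα
  obtain ⟨c, hc⟩ := h 1 (by omega)
  obtain ⟨d, hd⟩ := h n (by omega)
  have hc' := hk _ _ hc
  have hd' := hk _ _ hd
  have bc := hc.bounds
  have bd := hd.bounds
  have hk0 : k = 0 := by
    cases b <;> simp only [image, Bool.false_eq_true, if_false, if_true] at hc' hd' <;> omega
  have hA : Acts α (fun a => 1 ≤ a ∧ a ≤ n) (image n k b) := by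
    intro x y
    constructor
    · exact fun hxy => ⟨hxy.bounds.1, hk _ _ hxy⟩
    · rintro ⟨hx, rfl⟩
      obtain ⟨y, hy⟩ := h x hx
      rwa [← hk _ _ hy]
  subst hk0
  cases b
  · exact Or.inl (hA.eq acts_one (fun a => Iff.rfl) fun a _ => by simp [image])
  · exact Or.inr (hA.eq graph_hMap (fun a => Iff.rfl) fun a _ => by simp [image])

theorem definedAt_mul {α β : PartialPerm n} {a : ℤ} :
    DefinedAt (α * β) a ↔ ∃ b, Graph α a b ∧ DefinedAt β b := by
  simp only [DefinedAt, graph_mul]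
  exact ⟨fun ⟨c, b, h1, h2⟩ => ⟨b, h1, c, h2⟩, fun ⟨b, h1, c, h2⟩ => ⟨c, b, h1, h2⟩⟩

theorem DefinedAt.of_mul {α β : PartialPerm n} {a : ℤ} (h : DefinedAt (α * β) a) :
    DefinedAt α a := by
  obtain ⟨b, h1, -⟩ := definedAt_mul.1 h
  exact ⟨b, h1⟩

/-- The reflection belongs to every generating set. -/
theorem reflection_mem (hn : 3 ≤ n) {S : Set (DP n)} (hS : Submonoid.closure S = ⊤) :
    ⟨hMap n, hMap_mem n⟩ ∈ S := by
  by_contra hh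
  -- The first factor of a total product is total, hence `1` or `h`; without `h` in `S`, every total
  -- product is trivial.
  have key : ∀ w : DP n, (∀ a : ℤ, 1 ≤ a ∧ a ≤ n → DefinedAt (w : PartialPerm n) a) → w = 1 := by
    intro w
    have hw : w ∈ Submonoid.closure S := by rw [hS]; trivial
    induction hw using Submonoid.closure_induction_left with
    | one => exact fun _ => rfl
    | mul_left s hs w _ ih =>
      intro hd
      rcases total_cases s.2 (by omega) fun a ha => (hd a ha).of_mul with h1 | h1
      · have : s = 1 := Subtype.ext h1
        rw [this, one_mul] at hd ⊢
        exact ih hd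
      · have : s = ⟨hMap n, hMap_mem n⟩ := Subtype.ext h1
        exact absurd (this ▸ hs) hh
  have h1 := congrArg Subtype.val
    (key ⟨hMap n, hMap_mem n⟩ fun a ha => ⟨_, (graph_hMap _ _).2 ⟨ha, rfl⟩⟩)
  have h2 := graph_one (n := n) 1 n
  rw [← Submonoid.coe_one (DP n), ← h1, graph_hMap] at h2
  omega

/-- Every generating set contains, for each `p`, an element whose domain misses exactly `p` or
exactly the mirror image of `p`. -/
theorem exists_mem_missing (hn : 3 ≤ n) {S : Set (DP n)} (hS : Submonoid.closure S = ⊤) {p : ℤ}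
    (hp : 1 ≤ p ∧ p ≤ n) :
    ∃ s ∈ S, ∃ q : ℤ, (q = p ∨ q = n + 1 - p) ∧
      ∀ a, DefinedAt (s : PartialPerm n) a ↔ (1 ≤ a ∧ a ≤ n) ∧ a ≠ q := by
  have key : ∀ w : DP n, ∀ p : ℤ, 1 ≤ p ∧ p ≤ n →
      (∀ a, DefinedAt (w : PartialPerm n) a ↔ (1 ≤ a ∧ a ≤ n) ∧ a ≠ p) →
      ∃ s ∈ S, ∃ q : ℤ, (q = p ∨ q = n + 1 - p) ∧
        ∀ a, DefinedAt (s : PartialPerm n) a ↔ (1 ≤ a ∧ a ≤ n) ∧ a ≠ q := by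
    intro w
    have hw : w ∈ Submonoid.closure S := by rw [hS]; trivial
    induction hw using Submonoid.closure_induction_left with
    | one =>
      intro p hp hd
      exact absurd rfl ((hd p).1 ⟨p, (graph_one p p).2 ⟨hp, rfl⟩⟩).2
    | mul_left s hs w _ ih =>
      intro p hp hd
      rw [Submonoid.coe_mul] at hd
      -- If the first factor is defined at `p`, it is `1` or `h` and can be dropped, at the cost of
      -- reflecting `p`; otherwise it misses exactly `p`.
      by_cases hsp : DefinedAt (s : PartialPerm n) p
      · have htot : ∀ a : ℤ, 1 ≤ a ∧ a ≤ n → DefinedAt (s : PartialPerm n) a := by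
          intro a ha
          by_cases hap : a = p
          · rwa [hap]
          · exact ((hd a).2 ⟨ha, hap⟩).of_mul
        rcases total_cases s.2 (by omega) htot with h1 | h1
        · rw [h1, one_mul] at hd
          exact ih p hp hd
        · have hw : ∀ a, DefinedAt (w : PartialPerm n) a ↔ (1 ≤ a ∧ a ≤ n) ∧ a ≠ n + 1 - p := by
            intro a
            by_cases ha : 1 ≤ a ∧ a ≤ n
            · have := hd (n + 1 - a)
              simp only [h1, definedAt_mul, graph_hMap] at this
              constructor
              · intro h
                have := this.1 ⟨a, ⟨by omega, by omega⟩, h⟩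
                exact ⟨ha, by omega⟩
              · intro h
                obtain ⟨b, ⟨_, rfl⟩, hb⟩ := this.2 ⟨by omega, by omega⟩
                rwa [sub_sub_cancel] at hb
            · exact ⟨fun h => absurd h.bounds ha, fun h => absurd h.1 ha⟩
          obtain ⟨s', hs', q, hq, hd'⟩ := ih (n + 1 - p) (by omega) hw
          exact ⟨s', hs', q, by omega, hd'⟩
      · refine ⟨s, hs, p, Or.inl rfl, fun a => ⟨fun h => ⟨h.bounds, ?_⟩, fun h => ?_⟩⟩
        · rintro rfl
          exact hsp h
        · exact ((hd a).2 h).of_mul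
  refine key (toDP hn (idemElt n p)) p hp fun a => ?_
  constructor
  · rintro ⟨b, hb⟩
    have := ((acts_idemElt hn p) _ _).1 hb
    omega
  · intro h
    exact ⟨a, ((acts_idemElt hn p) _ _).2 ⟨by omega, rfl⟩⟩

/-- The `⌊(n + 1) / 2⌋` orbits of `p ↦ n + 1 - p` need distinct generators, none of them the total
map `h`. -/
theorem le_card_of_closure_eq_top (hn : 3 ≤ n) {S : Finset (DP n)}
    (hS : Submonoid.closure (S : Set (DP n)) = ⊤) : (n + 3) / 2 ≤ S.card := by
  have h1 : ∀ p : ℕ, ∃ s ∈ S, p ∈ Finset.Icc 1 ((n + 1) / 2) → ∃ q : ℤ,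
      (q = p ∨ q = n + 1 - p) ∧
        ∀ a, DefinedAt (s : PartialPerm n) a ↔ (1 ≤ a ∧ a ≤ n) ∧ a ≠ q := by
    intro p
    by_cases hp : p ∈ Finset.Icc 1 ((n + 1) / 2)
    · rw [Finset.mem_Icc] at hp
      obtain ⟨s, hs, q, hq⟩ := exists_mem_missing hn hS (p := p) (by omega)
      exact ⟨s, hs, fun _ => ⟨q, hq⟩⟩
    -- A default value outside the range, so that `choose` yields a function on all of `ℕ`.
    · exact ⟨_, reflection_mem hn hS, fun h => absurd h hp⟩
  choose f hf hq using h1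
  have hinj : Set.InjOn f (Finset.Icc 1 ((n + 1) / 2)) := by
    intro p hp p' hp' h
    obtain ⟨q, h1, h2⟩ := hq p hp
    obtain ⟨q', h1', h2'⟩ := hq p' hp'
    rw [Finset.coe_Icc, Set.mem_Icc] at hp hp'
    have h3 := h2 q
    rw [h, h2'] at h3
    omega
  have hh : (⟨hMap n, hMap_mem n⟩ : DP n) ∉ (Finset.Icc 1 ((n + 1) / 2)).image f := by
    intro h
    obtain ⟨p, hp, h⟩ := Finset.mem_image.1 h
    obtain ⟨q, h1, h2⟩ := hq p hp
    rw [Finset.mem_Icc] at hp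
    have h3 := h2 q
    rw [h] at h3
    have : DefinedAt (hMap n) q := ⟨_, (graph_hMap _ _).2 ⟨by omega, rfl⟩⟩
    exact (h3.1 this).2 rfl
  have hsub : insert ⟨hMap n, hMap_mem n⟩ ((Finset.Icc 1 ((n + 1) / 2)).image f) ⊆ S := by
    rw [Finset.insert_subset_iff]
    refine ⟨reflection_mem hn hS, ?_⟩
    rw [Finset.image_subset_iff]
    exact fun p _ => hf p
  have := Finset.card_le_card hsub
  rw [Finset.card_insert_of_notMem hh, Finset.card_image_of_injOn hinj, Nat.card_Icc] at this
  omega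

end

/-! ### Counting the relations -/

/-- The parameters of the relations of each of the fourteen kinds. -/
def relIndex (n : ℕ) : ℕ → Finset (Σ _ : ℕ, ℕ)
  | 0 => (Finset.Icc 1 ((n - 1) / 2)).sigma fun _ => {0}
  -- The larger index comes first, since the range of the smaller one depends on it.
  | 1 => (Finset.Icc 1 ((n - 1) / 2)).sigma fun j => Finset.Ico 1 j
  | 2 => (Finset.Icc 1 ((n - 1) / 2)).sigma fun _ => Finset.Ioc ((n - 1) / 2) (n - 2)
  | 3 => (Finset.Icc 1 ((n - 3) / 2)).sigma fun _ => {0}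
  | 4 => if 4 ≤ n then {⟨0, 0⟩} else ∅
  | 5 => (Finset.Icc 1 ((n - 4) / 2)).sigma fun _ => {0}
  | 12 => if Odd n then {⟨0, 0⟩} else ∅
  | _ => {⟨0, 0⟩}

/-- The relation of a given kind with given parameters. -/
def relPair (n : ℕ) : (Σ _ : ℕ, Σ _ : ℕ, ℕ) → Word n × Word n
  | ⟨0, i, _⟩ => (X n i ^ 2, X n i)
  | ⟨1, j, i⟩ => (X n i * X n j, X n j * X n i)
  | ⟨2, i, j⟩ => (X n i * H n * X n (n - j - 1) * H n, H n * X n (n - j - 1) * H n * X n i)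
  | ⟨3, i, _⟩ => (XN n * X n (i + 1), X n i * XN n)
  | ⟨4, _, _⟩ => (XN n * H n * X n ((n - 2) / 2) * H n, X n ((n - 1) / 2) * XN n)
  | ⟨5, i, _⟩ => (XN n * H n * X n i * H n, H n * X n (i + 1) * H n * XN n)
  | ⟨6, _, _⟩ => (XN n ^ 2 * H n * XN n * H n, H n * X n 1 * H n * XN n)
  | ⟨7, _, _⟩ => (H n * XN n * H n * XN n ^ 2, XN n * X n 1)
  | ⟨8, _, _⟩ => (XN n * H n * XN n * H n * XN n, XN n)
  | ⟨9, _, _⟩ => (XN n ^ n,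
      ascWord n ((n - 1) / 2) * H n * descWord n ((n - 2) / 2) * XN n * X n 1 * H n)
  | ⟨10, _, _⟩ => (XN n ^ (n + 1), XN n ^ n)
  | ⟨11, _, _⟩ => (H n ^ 2, 1)
  | ⟨12, _, _⟩ => (H n * X n ((n - 1) / 2), X n ((n - 1) / 2) * H n)
  | ⟨_, _, _⟩ => (XN n ^ (n - 1) * H n,
      XN n * H n * XN n * ascWord n ((n - 2) / 2) * H n * descWord n ((n - 1) / 2))

/-- The indices of all relations. -/
def relIndices (n : ℕ) : Finset (Σ _ : ℕ, Σ _ : ℕ, ℕ) := (Finset.range 14).sigma (relIndex n)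

section
variable {n : ℕ}

theorem relationSet_eq : relationSet n = relPair n '' (relIndices n : Set _) := by
  ext ⟨u, v⟩
  simp only [relationSet, Set.mem_ofPred_eq, Set.mem_image, Finset.mem_coe, relIndices]
  constructor
  · intro h
    cases h with
    | idem i h1 h2 => exact ⟨⟨0, i, 0⟩, by simp [relIndex, h1, h2], rfl⟩
    | comm i j h1 h2 h3 => exact ⟨⟨1, j, i⟩, by simp [relIndex]; omega, rfl⟩
    | commConj i j h1 h2 h3 h4 => exact ⟨⟨2, i, j⟩, by simp [relIndex]; omega, rfl⟩
    | shift i h1 h2 => exact ⟨⟨3, i, 0⟩, by simp [relIndex, h1, h2], rfl⟩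
    | shiftMid h1 => exact ⟨⟨4, 0, 0⟩, by simp [relIndex, h1], rfl⟩
    | shiftConj i h1 h2 => exact ⟨⟨5, i, 0⟩, by simp [relIndex, h1, h2], rfl⟩
    | rel7 => exact ⟨⟨6, 0, 0⟩, by simp [relIndex], rfl⟩
    | rel8 => exact ⟨⟨7, 0, 0⟩, by simp [relIndex], rfl⟩
    | rel10 => exact ⟨⟨8, 0, 0⟩, by simp [relIndex], rfl⟩
    | rel11 => exact ⟨⟨9, 0, 0⟩, by simp [relIndex], rfl⟩
    | rel12 => exact ⟨⟨10, 0, 0⟩, by simp [relIndex], rfl⟩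
    | invol => exact ⟨⟨11, 0, 0⟩, by simp [relIndex], rfl⟩
    | central h1 => exact ⟨⟨12, 0, 0⟩, by simp [relIndex, h1], rfl⟩
    | rank1 => exact ⟨⟨13, 0, 0⟩, by simp [relIndex], rfl⟩
  · rintro ⟨⟨t, i, j⟩, ht, h⟩
    rw [Finset.mem_sigma, Finset.mem_range] at ht
    obtain ⟨ht, hij⟩ := ht
    simp only at ht hij
    obtain ⟨rfl, rfl⟩ := Prod.ext_iff.1 h
    interval_cases t
    · simp [relIndex] at hij
      exact .idem i hij.1.1 hij.1.2
    · simp [relIndex] at hij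
      exact .comm j i hij.2.1 hij.2.2 hij.1.2
    · simp [relIndex] at hij
      exact .commConj i j hij.1.1 hij.1.2 hij.2.1 hij.2.2
    · simp [relIndex] at hij
      exact .shift i hij.1.1 hij.1.2
    · by_cases h4 : 4 ≤ n
      · exact .shiftMid h4
      · simp [relIndex, h4] at hij
    · simp [relIndex] at hij
      exact .shiftConj i hij.1.1 hij.1.2
    · exact .rel7
    · exact .rel8
    · exact .rel10
    · exact .rel11
    · exact .rel12
    · exact .invol
    · by_cases h4 : Odd n
      · exact .central h4
      · simp [relIndex, h4] at hij
    · exact .rank1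

theorem sum_Icc_sub_one (m : ℕ) : 2 * ∑ j ∈ Finset.Icc 1 m, (j - 1) = m * (m - 1) := by
  induction m with
  | zero => simp
  | succ m ih =>
    rw [Finset.sum_Icc_succ_top (by omega), mul_add, ih]
    cases m with
    | zero => rfl
    | succ m => simp only [Nat.add_sub_cancel]; ring

theorem card_relIndices_odd (k : ℕ) (hk : 1 ≤ k) :
    2 * (relIndices (2 * k + 1)).card = 3 * k ^ 2 + 3 * k + 12 := by
  have h := sum_Icc_sub_one k
  have ho : Odd (2 * k + 1) := ⟨k, rfl⟩
  rw [relIndices, Finset.card_sigma]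
  simp only [Finset.sum_range_succ, Finset.sum_range_zero, relIndex, Finset.card_sigma,
    Finset.card_singleton, Finset.sum_const, Nat.card_Icc, Nat.card_Ico, Nat.card_Ioc, smul_eq_mul,
    if_pos ho, show (2 * k + 1 - 1) / 2 = k by omega, show (2 * k + 1 - 3) / 2 = k - 1 by omega,
    show (2 * k + 1 - 4) / 2 = k - 2 by omega, show 2 * k + 1 - 2 - k = k - 1 by omega]
  obtain ⟨k, rfl⟩ : ∃ j, k = j + 1 := ⟨k - 1, by omega⟩
  cases k with
  -- For `n = 3` the relation `shiftMid` is absent, while truncated subtraction counts `0` instead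
  -- of `-1` relations `shiftConj`; the two deviations cancel.
  | zero => simp
  | succ k =>
    rw [if_pos (by omega), Finset.card_singleton]
    simp only [Nat.add_sub_cancel] at h ⊢
    rw [show k + 1 + 1 - 2 = k by omega]
    nlinarith

theorem card_relIndices_even (k : ℕ) (hk : 1 ≤ k) :
    2 * (relIndices (2 * k + 2)).card = 3 * k ^ 2 + 5 * k + 12 := by
  have h := sum_Icc_sub_one k
  have ho : ¬ Odd (2 * k + 2) := by
    rw [Nat.not_odd_iff_even]
    exact ⟨k + 1, by ring⟩
  rw [relIndices, Finset.card_sigma]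
  simp only [Finset.sum_range_succ, Finset.sum_range_zero, relIndex, Finset.card_sigma,
    Finset.card_singleton, Finset.sum_const, Nat.card_Icc, Nat.card_Ico, Nat.card_Ioc, smul_eq_mul,
    if_neg ho, show (2 * k + 2 - 1) / 2 = k by omega, show (2 * k + 2 - 3) / 2 = k - 1 by omega,
    show (2 * k + 2 - 4) / 2 = k - 1 by omega, show 2 * k + 2 - 2 - k = k by omega,
    if_pos (show 4 ≤ 2 * k + 2 by omega), Finset.card_empty]
  obtain ⟨k, rfl⟩ : ∃ j, k = j + 1 := ⟨k - 1, by omega⟩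
  simp only [Nat.add_sub_cancel] at h ⊢
  nlinarith

/-- A code for letters. -/
def Letter.code : Letter n → ℕ
  | .h => 0
  | .xn => 1
  | .x i => i + 2

/-- The codes of the letters of a word. -/
def codes (w : Word n) : List ℕ := (FreeMonoid.toList w).map Letter.code

theorem codes_mul (u v : Word n) : codes (u * v) = codes u ++ codes v := by
  simp [codes]

theorem codes_H : codes (H n) = [0] := rfl

theorem codes_XN : codes (XN n) = [1] := rfl

theorem codes_X {i : ℕ} (h1 : 1 ≤ i) (h2 : i ≤ (n - 1) / 2) : codes (X n i) = [i + 1] := by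
  rw [X, dif_pos ⟨h1, h2⟩]
  change [i - 1 + 2] = _
  congr 1
  omega

theorem codes_XN_pow (k : ℕ) : codes (XN n ^ k) = List.replicate k 1 := by
  induction k with
  | zero => rfl
  | succ k ih => rw [pow_succ, codes_mul, ih, codes_XN, List.replicate_succ']

/-- The codes of the left hand sides of the relations. -/
def leftCode (n : ℕ) : (Σ _ : ℕ, Σ _ : ℕ, ℕ) → List ℕ
  | ⟨0, i, _⟩ => [i + 1, i + 1]
  | ⟨1, j, i⟩ => [i + 1, j + 1]
  | ⟨2, i, j⟩ => [i + 1, 0, n - j - 1 + 1, 0]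
  | ⟨3, i, _⟩ => [1, i + 2]
  | ⟨4, _, _⟩ => [1, 0, (n - 2) / 2 + 1, 0]
  | ⟨5, i, _⟩ => [1, 0, i + 1, 0]
  | ⟨6, _, _⟩ => [1, 1, 0, 1, 0]
  | ⟨7, _, _⟩ => [0, 1, 0, 1, 1]
  | ⟨8, _, _⟩ => [1, 0, 1, 0, 1]
  -- Leading entries are split off, as `3 ≤ n` permits, so that comparison with the short words sees
  -- them.
  | ⟨9, _, _⟩ => 1 :: 1 :: 1 :: List.replicate (n - 3) 1
  | ⟨10, _, _⟩ => 1 :: 1 :: 1 :: 1 :: List.replicate (n - 3) 1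
  | ⟨11, _, _⟩ => [0, 0]
  | ⟨12, _, _⟩ => [0, (n - 1) / 2 + 1]
  | ⟨_, _, _⟩ => 1 :: 1 :: (List.replicate (n - 3) 1 ++ [0])

theorem codes_relPair (hn : 3 ≤ n) {q : Σ _ : ℕ, Σ _ : ℕ, ℕ} (hq : q ∈ relIndices n) :
    codes (relPair n q).1 = leftCode n q := by
  obtain ⟨t, i, j⟩ := q
  rw [relIndices, Finset.mem_sigma, Finset.mem_range] at hq
  obtain ⟨ht, hij⟩ := hq
  simp only at ht hij
  have e : ∀ k, List.replicate (k + 1) 1 = 1 :: List.replicate k 1 := fun _ => rfl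
  interval_cases t
  · simp [relIndex] at hij
    simp [relPair, leftCode, pow_two, codes_mul, codes_X hij.1.1 hij.1.2]
  · simp [relIndex] at hij
    simp [relPair, leftCode, codes_mul, codes_X hij.1.1 hij.1.2,
      codes_X (n := n) (i := j) (by omega) (by omega)]
  · simp [relIndex] at hij
    simp [relPair, leftCode, codes_mul, codes_X hij.1.1 hij.1.2, codes_H,
      codes_X (n := n) (i := n - j - 1) (by omega) (by omega)]
  · simp [relIndex] at hij
    simp [relPair, leftCode, codes_mul, codes_XN,
      codes_X (n := n) (i := i + 1) (by omega) (by omega)]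
  · by_cases h4 : 4 ≤ n
    · simp [relPair, leftCode, codes_mul, codes_XN, codes_H,
        codes_X (n := n) (i := (n - 2) / 2) (by omega) (by omega)]
    · simp [relIndex, h4] at hij
  · simp [relIndex] at hij
    simp [relPair, leftCode, codes_mul, codes_XN, codes_H,
      codes_X (n := n) (i := i) (by omega) (by omega)]
  · simp [relPair, leftCode, pow_two, codes_mul, codes_XN, codes_H]
  · simp [relPair, leftCode, pow_two, codes_mul, codes_XN, codes_H]
  · simp [relPair, leftCode, codes_mul, codes_XN, codes_H]
  · simp only [relPair, leftCode, codes_XN_pow, ← e]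
    congr 1
    omega
  · simp only [relPair, leftCode, codes_XN_pow, ← e]
    congr 1
    omega
  · simp [relPair, leftCode, pow_two, codes_mul, codes_H]
  · simp [relPair, leftCode, codes_mul, codes_H,
      codes_X (n := n) (i := (n - 1) / 2) (by omega) (by omega)]
  · simp only [relPair, leftCode, codes_mul, codes_XN_pow, codes_H, ← List.cons_append, ← e]
    congr 2
    omega

-- Lengths, numbers of letters `h` and individual entries distinguish the left-hand sides, both
-- across kinds and within one kind.
set_option maxHeartbeats 4000000 in
theorem leftCode_injOn (hn : 3 ≤ n) : Set.InjOn (leftCode n) (relIndices n) := by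
  rintro ⟨t, i, j⟩ hq ⟨t', i', j'⟩ hq' h
  rw [Finset.mem_coe, relIndices, Finset.mem_sigma, Finset.mem_range] at hq hq'
  obtain ⟨ht, hij⟩ := hq
  obtain ⟨ht', hij'⟩ := hq'
  simp only at ht hij ht' hij'
  have mem_ite : ∀ (p : Prop) [Decidable p] (q : Σ _ : ℕ, ℕ),
      q ∈ (if p then {⟨0, 0⟩} else ∅ : Finset (Σ _ : ℕ, ℕ)) ↔ p ∧ q = ⟨0, 0⟩ := by
    intro p _ q
    split_ifs with hp <;> simp [hp]
  have hc := congrArg (List.count 0) h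
  have hl := congrArg List.length h
  interval_cases t <;> interval_cases t' <;>
    simp [leftCode, relIndex, mem_ite, List.count_replicate] at h hc hl hij hij' ⊢ <;>
    omega

theorem relPair_injOn (hn : 3 ≤ n) : Set.InjOn (relPair n) (relIndices n) := by
  intro q hq q' hq' h
  refine leftCode_injOn hn hq hq' ?_
  rw [← codes_relPair hn hq, ← codes_relPair hn hq', h]

theorem finite_relationSet : (relationSet n).Finite := by
  rw [relationSet_eq]
  exact (Finset.finite_toSet _).image _

theorem ncard_relationSet (hn : 3 ≤ n) : (relationSet n).ncard = (relIndices n).card := by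
  rw [relationSet_eq, (relPair_injOn hn).ncard_image, Set.ncard_coe_finset]

theorem ncard_relationSet_odd (hn : 3 ≤ n) (ho : Odd n) :
    ((relationSet n).ncard : ℚ) = 3 / 8 * (n : ℚ) ^ 2 + 45 / 8 := by
  rw [ncard_relationSet hn]
  obtain ⟨k, rfl⟩ := ho
  have h : (2 : ℚ) * (relIndices (2 * k + 1)).card = 3 * k ^ 2 + 3 * k + 12 := by
    exact_mod_cast card_relIndices_odd k (by omega)
  push_cast
  linarith

theorem ncard_relationSet_even (hn : 3 ≤ n) (he : Even n) :
    ((relationSet n).ncard : ℚ) = 3 / 8 * (n : ℚ) ^ 2 - 1 / 4 * (n : ℚ) + 5 := by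
  rw [ncard_relationSet hn]
  obtain ⟨k, rfl⟩ : ∃ k, n = 2 * k + 2 := by
    obtain ⟨j, rfl⟩ := he
    exact ⟨j - 1, by omega⟩
  have h : (2 : ℚ) * (relIndices (2 * k + 2)).card = 3 * k ^ 2 + 5 * k + 12 := by
    exact_mod_cast card_relIndices_even k (by omega)
  push_cast
  linarith

end

end PartialIsometry

/-- `DP_n` is defined by the presentation `⟨C | V⟩`: `C` is a set of `⌊(n+3)/2⌋` elements of
`DP_n`, the least size of a generating set, the letters of `C` correspond to these elements under
an isomorphism from the presented monoid onto `DP_n`, and `V` has the stated number of elements. -/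
theorem mainTheorem3 (n : ℕ) (hn : 3 ≤ n) :
    (∃ φ : PresentedMonoid (PartialIsometry.Relations n) ≃* PartialIsometry.DP n,
      ∀ c : PartialIsometry.Letter n,
        φ (PresentedMonoid.of (PartialIsometry.Relations n) c) = PartialIsometry.gen n c) ∧
    Function.Injective (PartialIsometry.gen n) ∧
    Nat.card (PartialIsometry.Letter n) = (n + 3) / 2 ∧
    Submonoid.closure (Set.range (PartialIsometry.gen n)) = ⊤ ∧
    (∀ S : Finset (PartialIsometry.DP n),
      Submonoid.closure (S : Set (PartialIsometry.DP n)) = ⊤ → (n + 3) / 2 ≤ S.card) ∧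
    (PartialIsometry.relationSet n).Finite ∧
    (Odd n → ((PartialIsometry.relationSet n).ncard : ℚ) = 3 / 8 * (n : ℚ) ^ 2 + 45 / 8) ∧
    (Even n → ((PartialIsometry.relationSet n).ncard : ℚ) =
      3 / 8 * (n : ℚ) ^ 2 - 1 / 4 * (n : ℚ) + 5) := by
  open PartialIsometry in
  exact ⟨⟨equivDP hn, equivDP_of hn⟩, gen_injective hn, card_letter hn, closure_range_gen hn,
    fun _ hS => le_card_of_closure_eq_top hn hS, finite_relationSet, ncard_relationSet_odd hn,
    ncard_relationSet_even hn⟩
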